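/- Let $F$ be a free group of finite rank at least $2$ and let $\phi:F\to F$ be an injective endomorphism. Definitions. A \emph{subgroup system} of $F$ is either the trivial system $\{1\}$, whose only component is the trivial subgroup, or a nonempty finite set of nontrivial subgroups of $F$, called its components; it is finitely generated if all its components are. A \emph{free factor system} is either the trivial system or a nonempty finite set $\{A_1,\dots,A_l\}$ of nontrivial subgroups of $F$ such that $\langle A_1,\dots,A_l\rangle$ is the internal free product $A_1*\cdots*A_l$ and is a free factor of $F$. A subgroup system $\mathcal A$ \emph{carries} a subgroup system $\mathcal B$ if for every $B\in\mathcal B$ there are $A\in\mathcal A$ and $x\in F$ with $B\le xAx^{-1}$; it carries the conjugacy class $[g]$ of $g\in F$ if $g\in xAx^{-1}$ for some $A\in\mathcal A$ and $x\in F$. Carrying is a preorder on free factor systems, and two free factor systems are equivalent if each carries the other. A subgroup system $\mathcal A=\{A_1,\dots,A_l\}$ is \emph{$[\phi]$-fixed} if there is a permutation $\sigma$ of $\{1,\dots,l\}$ such that $\phi(A_i)$ is conjugate in $F$ to $A_{\sigma(i)}$ for every $i$. A conjugacy class $[g]$ of $F$ \emph{has an infinite $[\phi]$-tail} if for every $n\ge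 1$ there is $g_n\in F$ such that $\phi^n(g_n)$ is conjugate to $g$ in $F$. Proposition. Among the $[\phi]$-fixed free factor systems of $F$, preordered by carrying, there is a maximal one $\mathcal A$, and it is unique up to equivalence. Moreover, $\mathcal A$ carries every conjugacy class of $F$ that has an infinite $[\phi]$-tail and every finitely generated $[\phi]$-fixed subgroup system of $F$. -/

import Mathlib

/-! Systems of subgroups of a group `F`: a system is a finite set of subgroups, its components. -/

namespace SubgroupSystem

variable {F : Type*} [Group F]

/-- The conjugate subgroup `x A x⁻¹`. -/
def conjBy (x : F) (A : Subgroup F) : Subgroup F :=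
  A.map (MulAut.conj x).toMonoidHom

/-- The trivial system `{1}`, or a nonempty finite set of nontrivial subgroups. -/
def IsSystem (𝒜 : Finset (Subgroup F)) : Prop :=
  𝒜 = {⊥} ∨ (𝒜.Nonempty ∧ ∀ A ∈ 𝒜, A ≠ ⊥)

/-- Every component is finitely generated. -/
def IsFG (𝒜 : Finset (Subgroup F)) : Prop :=
  ∀ A ∈ 𝒜, A.FG

/-- `F` is the internal free product of `A` and some subgroup `B`. -/
def IsFreeFactor (A : Subgroup F) : Prop :=
  ∃ B : Subgroup F, Function.Bijective (Monoid.Coprod.lift A.subtype B.subtype)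

/-- A nonempty finite set of nontrivial subgroups `A₁, …, Aₗ` such that the subgroup
`⟨A₁, …, Aₗ⟩` is the internal free product `A₁ * ⋯ * Aₗ` and is a free factor of `F`.
Consequently each `Aᵢ` is a free factor of `F`, and distinct components meet trivially. -/
def IsNontrivialFreeFactorSystem (𝒜 : Finset (Subgroup F)) : Prop :=
  𝒜.Nonempty ∧ (∀ A ∈ 𝒜, A ≠ ⊥) ∧
    Function.Injective (Monoid.CoprodI.lift fun A : 𝒜 => (A : Subgroup F).subtype) ∧
    IsFreeFactor (⨆ A ∈ 𝒜, A)

/-- The trivial system `{1}`, or a nontrivial free factor system. -/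
def IsFreeFactorSystem (𝒜 : Finset (Subgroup F)) : Prop :=
  𝒜 = {⊥} ∨ IsNontrivialFreeFactorSystem 𝒜

/-- `𝒜` carries `ℬ`: every component of `ℬ` lies in a conjugate of a component of `𝒜`. -/
def Carries (𝒜 ℬ : Finset (Subgroup F)) : Prop :=
  ∀ B ∈ ℬ, ∃ A ∈ 𝒜, ∃ x : F, B ≤ conjBy x A

/-- `𝒜` carries the conjugacy class of `g`. -/
def CarriesClass (𝒜 : Finset (Subgroup F)) (g : F) : Prop :=
  ∃ A ∈ 𝒜, ∃ x : F, g ∈ conjBy x A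

/-- The equivalence relation up to which free factor systems are considered. -/
def Equivalent (𝒜 ℬ : Finset (Subgroup F)) : Prop :=
  Carries 𝒜 ℬ ∧ Carries ℬ 𝒜

/-- `[φ]`-fixed: `φ` permutes the components up to conjugacy. -/
def IsFixed (φ : F →* F) (𝒜 : Finset (Subgroup F)) : Prop :=
  ∃ σ : Equiv.Perm 𝒜, ∀ A : 𝒜, ∃ x : F, (A : Subgroup F).map φ = conjBy x (σ A : Subgroup F)

/-- The conjugacy class of `g` has an infinite `[φ]`-tail. -/
def HasInfiniteTail (φ : F →* F) (g : F) : Prop :=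
  ∀ n : ℕ, 1 ≤ n → ∃ h : F, IsConj (φ^[n] h) g

/-- `𝒜` is a maximal element, for the carrying preorder, among the `[φ]`-fixed free factor
systems. -/
def IsMaximalFixedFreeFactorSystem (φ : F →* F) (𝒜 : Finset (Subgroup F)) : Prop :=
  IsFreeFactorSystem 𝒜 ∧ IsFixed φ 𝒜 ∧
    ∀ ℬ : Finset (Subgroup F), IsFreeFactorSystem ℬ → IsFixed φ ℬ → Carries ℬ 𝒜 → Carries 𝒜 ℬ

end SubgroupSystem

/-!
An element `g` has an infinite tail when it is conjugate into every image `φⁿ(F)`, so consider the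
action of `F` on the cosets of `φⁿ(F)`. For each `M`, look at the cosets where some nontrivial word
of length at most `M` is a loop. Choosing the edges of a spanning tree of the coset graph greedily,
the ones near short loops first, makes the tree meet every component of every one of these subgraphs
in a subtree. The edges outside the tree give a basis of `F ≅ φⁿ(F)`, and for each `M` the edges in
one component generate the image of a free factor. Every short loop uses one of the rank-many edges
outside the tree, so the components have bounded diameter, independently of `n`, and these images
are generated, up to conjugacy, by elements of bounded length. They carry every subgroup of
`φⁿ(F)` generated by words of length at most `M`.

Along an ultrafilter on `n` both the partition of the basis and the images stabilise. The maximal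
limit subgroups carry every finitely generated subgroup with an infinite tail, so `φ` permutes them
up to conjugacy. Applying `φ⁻ⁿ` for a suitable `n` turns them into free factors spanned by disjoint
parts of one basis of `F`. As every fixed free factor system consists of finitely generated
subgroups with infinite tails, this one is maximal.
-/

namespace SubgroupSystem

section Conjugation

variable {F G : Type*} [Group F] [Group G] {A B C : Subgroup F} {x y g : F}

lemma mem_conjBy : g ∈ conjBy x A ↔ x⁻¹ * g * x ∈ A := by
  rw [conjBy, Subgroup.mem_map_equiv, MulAut.conj_symm_apply]

@[simp]
lemma conjBy_one (A : Subgroup F) : conjBy 1 A = A := by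
  ext g
  simp [mem_conjBy]

lemma conjBy_conjBy (x y : F) (A : Subgroup F) : conjBy x (conjBy y A) = conjBy (x * y) A := by
  ext g
  simp [mem_conjBy, mul_assoc]

lemma conjBy_mono (x : F) (h : A ≤ B) : conjBy x A ≤ conjBy x B := Subgroup.map_mono h

lemma map_conjBy (ψ : F →* G) (x : F) (A : Subgroup F) :
    (conjBy x A).map ψ = conjBy (ψ x) (A.map ψ) := by
  simp only [conjBy, Subgroup.map_map]
  congr 1
  ext g
  simp

lemma fg_map (hA : A.FG) (ψ : F →* G) : (A.map ψ).FG := by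
  rw [Subgroup.fg_iff_submonoid_fg] at hA ⊢
  exact hA.map ψ

lemma fg_of_fg_map {ψ : F →* G} (hψ : Function.Injective ψ) (hA : (A.map ψ).FG) : A.FG := by
  rw [Subgroup.fg_iff_submonoid_fg] at hA ⊢
  exact hA.map_injective ψ hψ

/-- `A` is conjugate to `B`. -/
def Conjugate (A B : Subgroup F) : Prop := ∃ x : F, A = conjBy x B

/-- `A` lies in a conjugate of `B`. -/
def Subconjugate (A B : Subgroup F) : Prop := ∃ x : F, A ≤ conjBy x B

namespace Conjugate

lemma refl (A : Subgroup F) : Conjugate A A := ⟨1, (conjBy_one A).symm⟩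

lemma symm (h : Conjugate A B) : Conjugate B A := by
  obtain ⟨x, rfl⟩ := h
  exact ⟨x⁻¹, by simp [conjBy_conjBy]⟩

lemma trans (h : Conjugate A B) (h' : Conjugate B C) : Conjugate A C := by
  obtain ⟨x, rfl⟩ := h
  obtain ⟨y, rfl⟩ := h'
  exact ⟨x * y, conjBy_conjBy x y C⟩

lemma map (h : Conjugate A B) (ψ : F →* G) : Conjugate (A.map ψ) (B.map ψ) := by
  obtain ⟨x, rfl⟩ := h
  exact ⟨ψ x, map_conjBy ψ x B⟩

lemma subconjugate (h : Conjugate A B) : Subconjugate A B := h.imp fun _ h => h.le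

lemma fg (h : Conjugate A B) (hB : B.FG) : A.FG := by
  obtain ⟨x, rfl⟩ := h
  exact fg_map hB _

lemma ne_bot (h : Conjugate A B) (hB : B ≠ ⊥) : A ≠ ⊥ := by
  obtain ⟨x, rfl⟩ := h
  exact (Subgroup.map_eq_bot_iff_of_injective B (MulAut.conj x).injective).not.mpr hB

end Conjugate

namespace Subconjugate

lemma refl (A : Subgroup F) : Subconjugate A A := (Conjugate.refl A).subconjugate

lemma of_le (h : A ≤ B) : Subconjugate A B := ⟨1, by rwa [conjBy_one]⟩

lemma trans (h : Subconjugate A B) (h' : Subconjugate B C) : Subconjugate A C := by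
  obtain ⟨x, hx⟩ := h
  obtain ⟨y, hy⟩ := h'
  exact ⟨x * y, hx.trans (conjBy_conjBy x y C ▸ conjBy_mono x hy)⟩

lemma map (h : Subconjugate A B) (ψ : F →* G) : Subconjugate (A.map ψ) (B.map ψ) := by
  obtain ⟨x, hx⟩ := h
  exact ⟨ψ x, map_conjBy ψ x B ▸ Subgroup.map_mono hx⟩

end Subconjugate

end Conjugation

section Ball

open scoped Pointwise

variable {F X : Type*} [Group F]

/-- The elements of `F` that are spelled by a word of length at most `n` in the letters
`(γ x)^{±1}`. -/
def ball (γ : X → F) (n : ℕ) : Set F := insert 1 (Set.range γ ∪ (Set.range γ)⁻¹) ^ n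

variable {γ : X → F} {m n : ℕ} {g h : F}

lemma ball_finite [Finite X] (γ : X → F) (n : ℕ) : (ball γ n).Finite := by
  induction n with
  | zero => simp [ball]
  | succ n ih =>
    rw [ball, pow_succ]
    exact ih.mul (((Set.finite_range γ).union (Set.finite_range γ).inv).insert 1)

lemma ball_mono (h : m ≤ n) : ball γ m ⊆ ball γ n :=
  Set.pow_subset_pow_right (Set.mem_insert 1 _) h

lemma one_mem_ball (n : ℕ) : (1 : F) ∈ ball γ n := Set.one_mem_pow (Set.mem_insert 1 _)

lemma letter_mem_ball (x : X) : γ x ∈ ball γ 1 := by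
  simp [ball]

lemma mul_mem_ball (hg : g ∈ ball γ m) (hh : h ∈ ball γ n) : g * h ∈ ball γ (m + n) := by
  rw [ball, pow_add]
  exact Set.mul_mem_mul hg hh

lemma inv_mem_ball (hg : g ∈ ball γ n) : g⁻¹ ∈ ball γ n := by
  rw [← Set.mem_inv, ball, ← inv_pow, Set.inv_insert, Set.union_inv, inv_inv, inv_one,
    Set.union_comm]
  exact hg

lemma exists_mem_ball (hγ : Subgroup.closure (Set.range γ) = ⊤) (g : F) : ∃ n, g ∈ ball γ n := by
  have hg : g ∈ Subgroup.closure (Set.range γ) := hγ ▸ Subgroup.mem_top g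
  induction hg using Subgroup.closure_induction with
  | mem g hg =>
    obtain ⟨x, rfl⟩ := hg
    exact ⟨1, letter_mem_ball x⟩
  | one => exact ⟨0, one_mem_ball 0⟩
  | mul g h _ _ ihg ihh =>
    obtain ⟨m, hm⟩ := ihg
    obtain ⟨n, hn⟩ := ihh
    exact ⟨m + n, mul_mem_ball hm hn⟩
  | inv g _ ih => exact ih.imp fun n => inv_mem_ball

lemma exists_subset_ball (hγ : Subgroup.closure (Set.range γ) = ⊤) {s : Set F} (hs : s.Finite) :
    ∃ n, s ⊆ ball γ n := by
  choose n hn using exists_mem_ball hγ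
  obtain ⟨N, hN⟩ := (hs.image n).bddAbove
  exact ⟨N, fun g hg => ball_mono (hN (Set.mem_image_of_mem n hg)) (hn g)⟩

end Ball

section Walk

variable {F X V : Type*} [Group F] [MulAction F V]

/-- `Step γ S u a v`: the letter `a` is read along an edge in `S`, in either direction, from `u` to
`v`. Here `(v, x)` denotes the edge from `v` to `γ x • v` in the action graph of `F` on `V`. -/
inductive Step (γ : X → F) (S : Set (V × X)) : V → F → V → Prop
  | pos {v : V} {x : X} (h : (v, x) ∈ S) : Step γ S v (γ x) (γ x • v)
  | neg {v : V} {x : X} (h : (v, x) ∈ S) : Step γ S (γ x • v) (γ x)⁻¹ v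

/-- `Walk γ S u v n g`: the element `g` is spelled, from right to left, along a path of `n` edges in
`S` from `u` to `v`. -/
inductive Walk (γ : X → F) (S : Set (V × X)) (u : V) : V → ℕ → F → Prop
  | nil : Walk γ S u u 0 1
  | cons {v w : V} {n : ℕ} {a g : F} : Walk γ S u v n g → Step γ S v a w →
      Walk γ S u w (n + 1) (a * g)

/-- The vertices `u` and `v` are joined by a path of edges in `S`. -/
def Reachable (γ : X → F) (S : Set (V × X)) (u v : V) : Prop := ∃ n g, Walk γ S u v n g

/-- The edges in `S` that belong to the connected component of `u`. -/
def componentEdges (γ : X → F) (S : Set (V × X)) (u : V) : Set (V × X) :=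
  {e ∈ S | Reachable γ S u e.1}

variable {γ : X → F} {S T : Set (V × X)} {u v w : V} {m n : ℕ} {a g h : F}

namespace Step

lemma mono (s : Step γ S u a v) (hS : S ⊆ T) : Step γ T u a v := by
  cases s with
  | pos h => exact .pos (hS h)
  | neg h => exact .neg (hS h)

lemma symm (s : Step γ S u a v) : Step γ S v a⁻¹ u := by
  cases s with
  | pos h => exact .neg h
  | neg h => simpa using Step.pos h

lemma smul_eq (s : Step γ S u a v) : a • u = v := by
  cases s with
  | pos h => rfl
  | neg h => exact inv_smul_smul _ _

lemma mem_ball (s : Step γ S u a v) : a ∈ ball γ 1 := by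
  cases s with
  | pos h => exact letter_mem_ball _
  | neg h => exact inv_mem_ball (letter_mem_ball _)

lemma exists_edge (s : Step γ S u a v) :
    ∃ e ∈ S, (e.1 = u ∨ e.1 = v) ∧ ∀ T : Set (V × X), e ∈ T → Step γ T u a v := by
  cases s with
  | pos h => exact ⟨_, h, .inl rfl, fun _ => .pos⟩
  | neg h => exact ⟨_, h, .inr rfl, fun _ => .neg⟩

end Step

namespace Walk

lemma mono (w : Walk γ S u v n g) (hS : S ⊆ T) : Walk γ T u v n g := by
  induction w with
  | nil => exact .nil
  | cons _ s ih => exact ih.cons (s.mono hS)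

lemma single (s : Step γ S u a v) : Walk γ S u v 1 a := by
  simpa using Walk.nil.cons s

lemma trans (p : Walk γ S u v m g) (q : Walk γ S v w n h) : Walk γ S u w (m + n) (h * g) := by
  induction q with
  | nil => simpa using p
  | cons _ s ih => exact mul_assoc _ _ g ▸ ih.cons s

lemma symm (p : Walk γ S u v n g) : Walk γ S v u n g⁻¹ := by
  induction p with
  | nil => simpa using Walk.nil
  | cons _ s ih =>
    rw [mul_inv_rev, add_comm]
    exact (single s.symm).trans ih

lemma smul_eq (p : Walk γ S u v n g) : g • u = v := by
  induction p with
  | nil => exact one_smul F u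
  | cons _ s ih => rw [mul_smul, ih, s.smul_eq]

lemma mem_ball (p : Walk γ S u v n g) : g ∈ ball γ n := by
  induction p with
  | nil => exact one_mem_ball 0
  | cons _ s ih => exact add_comm _ 1 ▸ mul_mem_ball s.mem_ball ih

lemma exists_split (p : Walk γ S u v n g) {i : ℕ} (hi : i ≤ n) :
    ∃ z g₁ g₂, Walk γ S u z i g₁ ∧ Walk γ S z v (n - i) g₂ := by
  induction p with
  | nil =>
    obtain rfl : i = 0 := by omega
    exact ⟨u, 1, 1, .nil, .nil⟩
  | @cons v w n a g p s ih =>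
    rcases hi.lt_or_eq with hi | rfl
    · obtain ⟨z, g₁, g₂, p₁, p₂⟩ := ih (by omega)
      rw [Nat.sub_add_comm (by omega)]
      exact ⟨z, g₁, a * g₂, p₁, p₂.cons s⟩
    · exact ⟨w, a * g, 1, p.cons s, by simpa using Walk.nil⟩

lemma mem_componentEdges (p : Walk γ S u v n g) : Walk γ (componentEdges γ S u) u v n g := by
  induction p with
  | nil => exact .nil
  | cons p s ih =>
    obtain ⟨e, he, rfl | rfl, hstep⟩ := s.exists_edge
    · exact ih.cons (hstep _ ⟨he, _, _, p⟩)
    · exact ih.cons (hstep _ ⟨he, _, _, p.cons s⟩)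

lemma exists_finset (p : Walk γ S u v n g) :
    ∃ s : Finset (V × X), ↑s ⊆ S ∧ Walk γ (↑s) u v n g := by
  classical
  induction p with
  | nil => exact ⟨∅, by simp, .nil⟩
  | cons _ s ih =>
    obtain ⟨t, ht, p⟩ := ih
    obtain ⟨e, he, -, hstep⟩ := s.exists_edge
    exact ⟨insert e t, by simp [Set.insert_subset_iff, he, ht],
      (p.mono (by simp)).cons (hstep _ (by simp))⟩

lemma inside_or_exits (T : Set (V × X)) (p : Walk γ S u v n g) :
    Walk γ T u v n g ∨ ∃ e ∈ S \ T, ∃ m ≤ n, ∃ h, Walk γ S u e.1 m h := by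
  induction p with
  | nil => exact .inl .nil
  | @cons v w n a g p s ih =>
    rcases ih with ih | ⟨e, he, m, hm, h, q⟩
    · obtain ⟨e, he, hend, hstep⟩ := s.exists_edge
      by_cases hT : e ∈ T
      · exact .inl (ih.cons (hstep T hT))
      · rcases hend with rfl | rfl
        · exact .inr ⟨e, ⟨he, hT⟩, n, by omega, g, p⟩
        · exact .inr ⟨e, ⟨he, hT⟩, n + 1, le_rfl, a * g, p.cons s⟩
    · exact .inr ⟨e, he, m, by omega, h, q⟩

end Walk

open scoped Pointwise in
lemma exists_walk_of_mem_ball (hg : g ∈ ball γ n) (v : V) :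
    ∃ m ≤ n, Walk γ Set.univ v (g • v) m g := by
  induction n generalizing g with
  | zero =>
    obtain rfl : g = 1 := by simpa [ball] using hg
    exact ⟨0, le_rfl, by simpa using Walk.nil⟩
  | succ n ih =>
    rw [ball, pow_succ', Set.mem_mul] at hg
    obtain ⟨a, ha, h, hh, rfl⟩ := hg
    obtain ⟨m, hm, p⟩ := ih hh
    rw [mul_smul]
    rcases ha with rfl | ⟨x, rfl⟩ | ⟨x, hx⟩
    · exact ⟨m, by omega, by simpa using p⟩
    · exact ⟨m + 1, by omega, p.cons (.pos trivial)⟩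
    · obtain rfl : (γ x)⁻¹ = a := by rw [hx, inv_inv]
      refine ⟨m + 1, by omega, p.cons (Step.symm ?_)⟩
      simpa using Step.pos (γ := γ) (v := (γ x)⁻¹ • h • v) (x := x) (Set.mem_univ _)

end Walk

section Reachable

variable {F X V : Type*} [Group F] [MulAction F V] {γ : X → F} {S T : Set (V × X)} {u v w : V}

namespace Reachable

lemma refl (u : V) : Reachable γ S u u := ⟨0, 1, .nil⟩

lemma edge {e : V × X} (he : e ∈ S) : Reachable γ S e.1 (γ e.2 • e.1) :=
  ⟨1, γ e.2, .single (.pos he)⟩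

lemma symm (h : Reachable γ S u v) : Reachable γ S v u := by
  obtain ⟨n, g, p⟩ := h
  exact ⟨n, g⁻¹, p.symm⟩

lemma trans (h : Reachable γ S u v) (h' : Reachable γ S v w) : Reachable γ S u w := by
  obtain ⟨m, g, p⟩ := h
  obtain ⟨n, k, q⟩ := h'
  exact ⟨m + n, k * g, p.trans q⟩

lemma mono (h : Reachable γ S u v) (hS : S ⊆ T) : Reachable γ T u v :=
  h.imp fun _ => .imp fun _ p => p.mono hS

lemma of_edges (hT : ∀ e ∈ S, Reachable γ T e.1 (γ e.2 • e.1)) (h : Reachable γ S u v) :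
    Reachable γ T u v := by
  obtain ⟨n, g, p⟩ := h
  induction p with
  | nil => exact refl u
  | cons _ s ih =>
    cases s with
    | pos he => exact ih.trans (hT _ he)
    | neg he => exact ih.trans (hT _ he).symm

end Reachable

lemma reachable_univ [MulAction.IsPretransitive F V] (hγ : Subgroup.closure (Set.range γ) = ⊤)
    (u v : V) : Reachable γ Set.univ u v := by
  obtain ⟨g, rfl⟩ := MulAction.exists_smul_eq F u v
  obtain ⟨n, hg⟩ := exists_mem_ball hγ g
  obtain ⟨m, -, p⟩ := exists_walk_of_mem_ball hg u
  exact ⟨m, g, p⟩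

end Reachable

section SpanningTree

variable {F X V : Type*} [Group F] [MulAction F V] {γ : X → F} {S T : Set (V × X)} {p : V → F}
  {u v v₀ : V} {n : ℕ} {g : F}

/-- The defect of `p` along the edge `e`. If `p v` is spelled by a path from a root to `v` for all
`v`, this is the element spelled by the closed path at the root that passes through `e`. -/
def edgeLoop (γ : X → F) (p : V → F) (e : V × X) : F := (p (γ e.2 • e.1))⁻¹ * γ e.2 * p e.1

/-- A function on vertices is a potential on `S` if it varies along the edges in `S` according to
their labels. -/
def IsPotential (γ : X → F) (S : Set (V × X)) (p : V → F) : Prop := ∀ e ∈ S, edgeLoop γ p e = 1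

lemma Walk.mem_closure (p : V → F) (q : Walk γ S u v n g) :
    (p v)⁻¹ * g * p u ∈ Subgroup.closure (edgeLoop γ p '' S) := by
  have hedge : ∀ e ∈ S, edgeLoop γ p e ∈ Subgroup.closure (edgeLoop γ p '' S) := fun e he =>
    Subgroup.subset_closure (Set.mem_image_of_mem _ he)
  induction q with
  | nil => simp
  | cons _ s ih =>
    cases s with
    | pos he => simpa [edgeLoop, mul_assoc] using mul_mem (hedge _ he) ih
    | neg he => simpa [edgeLoop, mul_assoc] using mul_mem (inv_mem (hedge _ he)) ih

lemma IsPotential.eq_mul (hp : IsPotential γ S p) (q : Walk γ S u v n g) : p v = g * p u := by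
  have hbot : Subgroup.closure (edgeLoop γ p '' S) = ⊥ := by
    rw [Subgroup.closure_eq_bot_iff]
    rintro _ ⟨e, he, rfl⟩
    exact hp e he
  have h := q.mem_closure p
  rw [hbot, Subgroup.mem_bot, mul_assoc, inv_mul_eq_one] at h
  exact h

lemma exists_isPotential_insert (hp : IsPotential γ S p) {e : V × X}
    (he : ¬Reachable γ S e.1 (γ e.2 • e.1)) : ∃ q : V → F, IsPotential γ (insert e S) q := by
  classical
  let c := (p e.1)⁻¹ * (γ e.2)⁻¹ * p (γ e.2 • e.1)
  refine ⟨fun v => if Reachable γ S e.1 v then p v * c else p v, ?_⟩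
  rintro f (rfl | hf)
  · simp [edgeLoop, he, Reachable.refl, c, mul_assoc]
  · have hiff : Reachable γ S e.1 (γ f.2 • f.1) ↔ Reachable γ S e.1 f.1 :=
      ⟨fun h => h.trans (Reachable.edge hf).symm, fun h => h.trans (Reachable.edge hf)⟩
    have hpf : (p (γ f.2 • f.1))⁻¹ * (γ f.2 * p f.1) = 1 := mul_assoc _ _ (p f.1) ▸ hp f hf
    by_cases h : Reachable γ S e.1 f.1
    · simp only [edgeLoop, hiff, h, if_true]
      calc _ = c⁻¹ * ((p (γ f.2 • f.1))⁻¹ * (γ f.2 * p f.1)) * c := by group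
        _ = 1 := by rw [hpf, mul_one, inv_mul_cancel]
    · simpa only [edgeLoop, hiff, h, if_false] using hp f hf

section Kruskal

variable {α : Type*} [LinearOrder α] {κ : V × X → α}

/-- Kruskal's minimal spanning forest: the edges that are not bridged by cheaper edges. -/
def kruskalTree (γ : X → F) (κ : V × X → α) : Set (V × X) :=
  {e | ¬Reachable γ {f | κ f < κ e} e.1 (γ e.2 • e.1)}

lemma exists_isPotential_of_subset_kruskalTree (hκ : Function.Injective κ) (s : Finset (V × X))
    (hs : ↑s ⊆ kruskalTree γ κ) : ∃ p : V → F, IsPotential γ (↑s) p := by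
  classical
  induction s using Finset.induction_on_max_value κ with
  | empty => exact ⟨fun _ => 1, by simp [IsPotential]⟩
  | insert e s hes hle ih =>
    rw [Finset.coe_insert, Set.insert_subset_iff] at hs
    obtain ⟨p, hp⟩ := ih hs.2
    rw [Finset.coe_insert]
    refine exists_isPotential_insert hp fun h => hs.1 (h.mono fun f hf => ?_)
    exact (hle f hf).lt_of_ne fun hfe => hes (hκ hfe ▸ hf)

lemma eq_one_of_walk_kruskalTree (hκ : Function.Injective κ)
    (q : Walk γ (kruskalTree γ κ) v v n g) : g = 1 := by
  obtain ⟨s, hs, q'⟩ := q.exists_finset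
  obtain ⟨p, hp⟩ := exists_isPotential_of_subset_kruskalTree hκ s hs
  exact right_eq_mul.mp (hp.eq_mul q')

lemma reachable_kruskalTree [WellFoundedLT α] (e : V × X) :
    Reachable γ (kruskalTree γ κ ∩ {f | κ f ≤ κ e}) e.1 (γ e.2 • e.1) := by
  induction he : κ e using WellFoundedLT.induction generalizing e with
  | ind a ih =>
    subst he
    by_cases he : e ∈ kruskalTree γ κ
    · exact Reachable.edge ⟨he, le_rfl⟩
    · refine (not_not.mp he).of_edges fun f hf => (ih _ hf f rfl).mono ?_
      exact Set.inter_subset_inter_right _ fun d hd => le_trans hd (le_of_lt hf)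

end Kruskal

/-- `T` is a spanning tree of the action graph, and `p v` is spelled by the path in `T` from the
root `v₀` to `v`. -/
structure IsSpanningTree (γ : X → F) (T : Set (V × X)) (v₀ : V) (p : V → F) : Prop where
  exists_walk : ∀ v, ∃ n, Walk γ T v₀ v n (p v)
  isPotential : IsPotential γ T p

theorem exists_isSpanningTree [MulAction.IsPretransitive F V]
    (hγ : Subgroup.closure (Set.range γ) = ⊤) {S : ℕ → Set (V × X)} (hS : Monotone S) (v₀ : V) :
    ∃ T p, IsSpanningTree γ T v₀ p ∧
      ∀ M u v, Reachable γ (S M) u v → Reachable γ (T ∩ S M) u v := by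
  let level (e : V × X) : ℕ∞ := ⨅ (M : ℕ) (_ : e ∈ S M), (M : ℕ∞)
  have level_le {e : V × X} {M : ℕ} : level e ≤ M ↔ e ∈ S M := by
    refine ⟨fun h => ?_, fun h => iInf₂_le M h⟩
    by_contra he
    have hlt : ((M + 1 : ℕ) : ℕ∞) ≤ level e := le_iInf₂ fun N hN =>
      Nat.cast_le.mpr (Nat.lt_of_not_le fun hNM => he (hS hNM hN))
    exact absurd (Nat.cast_le.mp (hlt.trans h)) (Nat.not_succ_le_self M)
  let κ (e : V × X) : ℕ∞ ×ₗ Cardinal := toLex (level e, embeddingToCardinal e)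
  have hκ : Function.Injective κ := fun e f h =>
    embeddingToCardinal.injective (congrArg Prod.snd (toLex.injective h))
  have hlevel {e f : V × X} (h : κ f ≤ κ e) : level f ≤ level e :=
    (Prod.Lex.le_iff.mp h).elim le_of_lt fun h => h.1.le
  have hspan : ∀ v, Reachable γ (kruskalTree γ κ) v₀ v := fun v =>
    (reachable_univ hγ v₀ v).of_edges fun e _ =>
      (reachable_kruskalTree (κ := κ) e).mono Set.inter_subset_left
  choose n p hp using hspan
  refine ⟨kruskalTree γ κ, p, ⟨fun v => ⟨n v, hp v⟩, fun e he => ?_⟩, fun M u v h => ?_⟩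
  · rw [edgeLoop, mul_assoc]
    exact eq_one_of_walk_kruskalTree hκ (((hp e.1).cons (.pos he)).trans (hp _).symm)
  · refine h.of_edges fun e he => (reachable_kruskalTree (κ := κ) e).mono ?_
    exact Set.inter_subset_inter_right _ fun f hf =>
      level_le.mp ((hlevel hf).trans (level_le.mpr he))

namespace IsSpanningTree

variable (hT : IsSpanningTree γ T v₀ p)
include hT

lemma smul_eq (v : V) : p v • v₀ = v := (hT.exists_walk v).choose_spec.smul_eq

lemma apply_root : p v₀ = 1 :=
  right_eq_mul.mp (hT.isPotential.eq_mul (hT.exists_walk v₀).choose_spec)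

end IsSpanningTree

end SpanningTree

section LoopGroup

variable {F X V : Type*} [Group F] [MulAction F V] {γ : X → F} {S T : Set (V × X)} {p : V → F}
  {u v v₀ : V} {D n : ℕ} {g : F}

/-- The fundamental group at `v` of the subgraph `S` of the action graph, as the subgroup of
elements that are spelled by a closed path in `S` at `v`. -/
def loopGroup (γ : X → F) (S : Set (V × X)) (v : V) : Subgroup F where
  carrier := {g | ∃ n, Walk γ S v v n g}
  one_mem' := ⟨0, .nil⟩
  mul_mem' := fun ⟨_, p⟩ ⟨_, q⟩ => ⟨_, q.trans p⟩
  inv_mem' := fun ⟨n, p⟩ => ⟨n, p.symm⟩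

lemma Walk.mem_loopGroup (q : Walk γ S v v n g) : g ∈ loopGroup γ S v := ⟨n, q⟩

lemma loopGroup_univ (hγ : Subgroup.closure (Set.range γ) = ⊤) (v : V) :
    loopGroup γ Set.univ v = MulAction.stabilizer F v := by
  ext g
  refine ⟨fun ⟨_, q⟩ => q.smul_eq, fun hg => ?_⟩
  obtain ⟨n, hn⟩ := exists_mem_ball hγ g
  obtain ⟨m, -, q⟩ := exists_walk_of_mem_ball hn v
  rw [MulAction.mem_stabilizer_iff.mp hg] at q
  exact q.mem_loopGroup

lemma loopGroup_eq_closure_ball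
    (hD : ∀ u, Reachable γ S v u → ∃ g, ∃ m ≤ D, Walk γ S v u m g) :
    loopGroup γ S v = Subgroup.closure (↑(loopGroup γ S v) ∩ ball γ (2 * D + 1)) := by
  refine le_antisymm ?_ ((Subgroup.closure_le _).mpr Set.inter_subset_left)
  rintro g ⟨n, q⟩
  choose! σ d hd hσ using hD
  have hloop : Subgroup.closure (edgeLoop γ σ '' componentEdges γ S v) ≤
      Subgroup.closure (↑(loopGroup γ S v) ∩ ball γ (2 * D + 1)) := by
    refine Subgroup.closure_mono ?_
    rintro _ ⟨e, ⟨he, hve⟩, rfl⟩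
    have h := hd _ hve
    have h' := hd _ (hve.trans (Reachable.edge he))
    have hwalk := ((hσ _ hve).cons (.pos he)).trans (hσ _ (hve.trans (Reachable.edge he))).symm
    rw [← mul_assoc] at hwalk
    exact ⟨hwalk.mem_loopGroup, ball_mono (by omega) hwalk.mem_ball⟩
  have hroot : σ v ∈ Subgroup.closure (↑(loopGroup γ S v) ∩ ball γ (2 * D + 1)) :=
    Subgroup.subset_closure ⟨(hσ v (.refl v)).mem_loopGroup,
      ball_mono (by have := hd v (.refl v); omega) (hσ v (.refl v)).mem_ball⟩
  have hg := hloop (q.mem_componentEdges.mem_closure σ)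
  rwa [mul_mem_cancel_right hroot, mul_mem_cancel_left (inv_mem hroot)] at hg

/-- On a shortest path, vertices `L + 1` edges apart are at distance more than `L`, so they are near
distinct elements of `C`. -/
lemma exists_walk_le_of_near {C : Type*} [Finite C] {L : ℕ} (near : V → C → Prop)
    (hnear : ∀ u, Reachable γ S v u → ∃ c, near u c)
    (hL : ∀ u w c, near u c → near w c → ∃ m ≤ L, ∃ g, Walk γ S u w m g)
    (hu : Reachable γ S v u) : ∃ g, ∃ m ≤ Nat.card C * (L + 1), Walk γ S v u m g := by
  classical
  obtain ⟨g, q⟩ := Nat.find_spec hu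
  refine ⟨g, _, ?_, q⟩
  by_contra! hlong
  have hbound : ∀ i : Fin (Nat.card C + 1), i * (L + 1) ≤ Nat.find hu := fun i =>
    (Nat.mul_le_mul_right _ (Nat.lt_succ_iff.mp i.2)).trans hlong.le
  choose z g₁ g₂ q₁ q₂ using fun i => q.exists_split (hbound i)
  choose c hc using fun i => hnear (z i) ⟨_, _, q₁ i⟩
  obtain ⟨i, j, hcij, hij⟩ := Function.not_injective_iff.mp fun h : Function.Injective c =>
    absurd (Nat.card_le_card_of_injective c h) (by simp)
  wlog hlt : i < j generalizing i j
  · exact this j i hcij.symm hij.symm (lt_of_le_of_ne (not_lt.mp hlt) hij.symm)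
  obtain ⟨m, hm, k, q'⟩ := hL (z i) (z j) (c i) (hc i) (hcij ▸ hc j)
  have hmin := Nat.find_min' hu ⟨_, ((q₁ i).trans q').trans (q₂ j)⟩
  have hgap : (i + 1) * (L + 1) ≤ j * (L + 1) := Nat.mul_le_mul_right _ hlt
  have := hbound j
  rw [add_mul] at hgap
  omega

namespace IsSpanningTree

variable (hT : IsSpanningTree γ T v₀ p)
include hT

lemma closure_edgeLoop_diff (S : Set (V × X)) :
    Subgroup.closure (edgeLoop γ p '' (S \ T)) = Subgroup.closure (edgeLoop γ p '' S) := by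
  refine le_antisymm (Subgroup.closure_mono (Set.image_mono Set.sdiff_subset)) ?_
  rw [Subgroup.closure_le]
  rintro _ ⟨e, he, rfl⟩
  by_cases heT : e ∈ T
  · exact (hT.isPotential e heT).symm ▸ one_mem _
  · exact Subgroup.subset_closure (Set.mem_image_of_mem _ ⟨he, heT⟩)

lemma loopGroup_eq_conjBy (hS : ∀ u v, Reachable γ S u v → Reachable γ (T ∩ S) u v) (u : V) :
    loopGroup γ S u =
      conjBy (p u) (Subgroup.closure (edgeLoop γ p '' (componentEdges γ S u \ T))) := by
  apply le_antisymm
  · rintro g ⟨n, q⟩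
    rw [mem_conjBy, hT.closure_edgeLoop_diff]
    exact q.mem_componentEdges.mem_closure p
  · rw [conjBy, MonoidHom.map_closure, Subgroup.closure_le]
    rintro _ ⟨_, ⟨e, ⟨⟨he, hue⟩, -⟩, rfl⟩, rfl⟩
    obtain ⟨m₁, h₁, q₁⟩ := hS _ _ hue
    obtain ⟨m₂, h₂, q₂⟩ := hS _ _ (hue.trans (Reachable.edge he))
    have hp₁ := hT.isPotential.eq_mul (q₁.mono Set.inter_subset_left)
    have hp₂ := hT.isPotential.eq_mul (q₂.mono Set.inter_subset_left)
    have hwalk := ((q₁.mono Set.inter_subset_right).cons (.pos he)).trans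
      (q₂.mono Set.inter_subset_right).symm
    convert hwalk.mem_loopGroup using 1
    simp [edgeLoop, hp₁, hp₂, mul_assoc]

lemma closure_edgeLoop_eq_stabilizer (hγ : Subgroup.closure (Set.range γ) = ⊤) :
    Subgroup.closure (edgeLoop γ p '' Tᶜ) = MulAction.stabilizer F v₀ := by
  have hreach : ∀ v, Reachable γ T v₀ v := fun v => (hT.exists_walk v).imp fun _ h => ⟨_, h⟩
  have h := hT.loopGroup_eq_conjBy (S := Set.univ)
    (fun u v _ => by simpa using (hreach u).symm.trans (hreach v)) v₀
  have huniv : componentEdges γ Set.univ v₀ = Set.univ :=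
    Set.eq_univ_of_forall fun e => ⟨trivial, (hreach e.1).mono (Set.subset_univ T)⟩
  rw [loopGroup_univ hγ, hT.apply_root, conjBy_one, huniv, ← Set.compl_eq_univ_sdiff] at h
  exact h.symm

end IsSpanningTree

end LoopGroup

section FreeLoops

variable {F X V : Type*} [Group F] [MulAction F V] {δ : FreeGroupBasis X F} {T : Set (V × X)}
  {p : V → F} {u v v₀ : V} {n : ℕ} {g : F}

open scoped Classical in
/-- The permutation of `V × FreeGroup Tᶜ` by which a letter acts: crossing an edge outside `T`
multiplies the second component by the corresponding generator. -/
noncomputable def labelStep (δ : FreeGroupBasis X F) (T : Set (V × X)) (x : X) :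
    Equiv.Perm (V × FreeGroup ↥Tᶜ) :=
  let a (v : V) : FreeGroup ↥Tᶜ := if h : (v, x) ∈ T then 1 else FreeGroup.of ⟨(v, x), h⟩
  { toFun := fun q => (δ x • q.1, a q.1 * q.2)
    invFun := fun q => ((δ x)⁻¹ • q.1, (a ((δ x)⁻¹ • q.1))⁻¹ * q.2)
    left_inv := fun q => by simp
    right_inv := fun q => by simp }

/-- The action of a free group on `V × FreeGroup Tᶜ` by `labelStep`, which records the edges outside
`T` that a path crosses. It shows that the loops through these edges are independent. -/
noncomputable def label (δ : FreeGroupBasis X F) (T : Set (V × X)) :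
    F →* Equiv.Perm (V × FreeGroup ↥Tᶜ) :=
  δ.lift (labelStep δ T)

lemma label_of_mem {e : V × X} (he : e ∈ T) (a : FreeGroup ↥Tᶜ) :
    label δ T (δ e.2) (e.1, a) = (δ e.2 • e.1, a) := by
  simp [label, labelStep, he]

lemma label_of_notMem (e : ↥Tᶜ) (a : FreeGroup ↥Tᶜ) :
    label δ T (δ e.1.2) (e.1.1, a) = (δ e.1.2 • e.1.1, FreeGroup.of e * a) := by
  have he : e.1 ∉ T := e.2
  simp [label, labelStep, he]

lemma label_walk (q : Walk δ T u v n g) (a : FreeGroup ↥Tᶜ) : label δ T g (u, a) = (v, a) := by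
  induction q with
  | nil => simp
  | cons _ s ih =>
    rw [map_mul, Equiv.Perm.mul_apply, ih]
    cases s with
    | pos he => exact label_of_mem he a
    | neg he => rw [map_inv, Equiv.Perm.inv_eq_iff_eq, label_of_mem he]

namespace IsSpanningTree

variable (hT : IsSpanningTree δ T v₀ p)
include hT

lemma label_edgeLoop (e : ↥Tᶜ) (a : FreeGroup ↥Tᶜ) :
    label δ T (edgeLoop δ p e) (v₀, a) = (v₀, FreeGroup.of e * a) := by
  obtain ⟨n, hn⟩ := hT.exists_walk e.1.1
  obtain ⟨m, hm⟩ := hT.exists_walk (δ e.1.2 • e.1.1)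
  rw [edgeLoop, map_mul, map_mul, Equiv.Perm.mul_apply, Equiv.Perm.mul_apply, label_walk hn,
    label_of_notMem, map_inv, Equiv.Perm.inv_eq_iff_eq, label_walk hm]

lemma label_lift_edgeLoop (w a : FreeGroup ↥Tᶜ) :
    label δ T (FreeGroup.lift (fun e : ↥Tᶜ => edgeLoop δ p e) w) (v₀, a) = (v₀, w * a) := by
  induction w using FreeGroup.induction_on generalizing a with
  | C1 => simp
  | of e => rw [FreeGroup.lift_apply_of, hT.label_edgeLoop]
  | inv_of e ih => rw [map_inv, map_inv, Equiv.Perm.inv_eq_iff_eq, ih, mul_inv_cancel_left]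
  | mul x y hx hy => rw [map_mul, map_mul, Equiv.Perm.mul_apply, hy, hx, mul_assoc]

lemma lift_edgeLoop_injective :
    Function.Injective (FreeGroup.lift fun e : ↥Tᶜ => edgeLoop δ p e) := by
  rw [injective_iff_map_eq_one]
  intro w hw
  simpa [hw] using (hT.label_lift_edgeLoop w 1).symm

end IsSpanningTree

end FreeLoops

section ShortEdges

variable {F X V : Type*} [Group F] [MulAction F V] {γ : X → F} {S T : Set (V × X)} {p : V → F}
  {u v v₀ : V} {k m n M : ℕ} {g h : F}

/-- The vertices of the action graph at which some closed path of length at most `M` spells a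
nontrivial element. -/
def shortVertices (γ : X → F) (V : Type*) [MulAction F V] (M : ℕ) : Set V :=
  {v | ∃ g ∈ ball γ M, g ≠ 1 ∧ g • v = v}

/-- The edges of the subgraph of the action graph that is induced by the short vertices. -/
def shortEdges (γ : X → F) (V : Type*) [MulAction F V] (M : ℕ) : Set (V × X) :=
  {e | e.1 ∈ shortVertices γ V M ∧ γ e.2 • e.1 ∈ shortVertices γ V M}

lemma monotone_shortEdges : Monotone (shortEdges γ V) := by
  have hmono : Monotone (shortVertices γ V) := fun _ _ h _ ⟨g, hg, hg'⟩ => ⟨g, ball_mono h hg, hg'⟩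
  exact fun _ _ h e he => ⟨hmono h he.1, hmono h he.2⟩

lemma Walk.in_shortEdges (p : Walk γ S u v n g) (q : Walk γ S v u k h) (hne : h * g ≠ 1)
    (hM : n + k ≤ M) : Walk γ (shortEdges γ V M) u v n g := by
  -- The closed path can be rotated to start at any of its vertices.
  have hshort {v : V} {n k : ℕ} {g h : F} (p : Walk γ S u v n g) (q : Walk γ S v u k h)
      (hne : h * g ≠ 1) (hM : n + k ≤ M) : v ∈ shortVertices γ V M :=
    ⟨g * h, ball_mono (by omega) (q.trans p).mem_ball, fun h1 => hne (mul_eq_one_comm.mp h1),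
      (q.trans p).smul_eq⟩
  induction p generalizing k h with
  | nil => exact .nil
  | @cons v w n a g p s ih =>
    have q' := (Walk.single s).trans q
    have hne' : h * a * g ≠ 1 := by rwa [mul_assoc]
    have hv := hshort p q' hne' (by omega)
    have hw := hshort (p.cons s) q hne hM
    refine (ih q' hne' (by omega)).cons ?_
    cases s with
    | pos _ => exact .pos ⟨hv, hw⟩
    | neg _ => exact .neg ⟨hw, hv⟩

lemma exists_walk_shortEdges (hg : g ∈ ball γ M) (hv : g • v = v) :
    ∃ n ≤ M, Walk γ (shortEdges γ V M) v v n g := by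
  rcases eq_or_ne g 1 with rfl | hne
  · exact ⟨0, Nat.zero_le M, .nil⟩
  obtain ⟨n, hn, q⟩ := exists_walk_of_mem_ball hg v
  rw [hv] at q
  exact ⟨n, hn, q.in_shortEdges .nil (by rwa [one_mul]) hn⟩

lemma Reachable.mem_shortVertices (h : Reachable γ (shortEdges γ V M) u v)
    (hu : u ∈ shortVertices γ V M) : v ∈ shortVertices γ V M := by
  obtain ⟨n, g, q⟩ := h
  cases q with
  | nil => exact hu
  | cons _ s =>
    cases s with
    | pos he => exact he.2
    | neg he => exact he.1

namespace IsSpanningTree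

variable (hT : IsSpanningTree γ T v₀ p)
include hT

lemma exists_exit (q : Walk γ S v v n g) (hg : g ≠ 1) :
    ∃ e ∈ S \ T, ∃ m ≤ n, ∃ h, Walk γ S v e.1 m h :=
  (q.inside_or_exits T).resolve_left fun q' => hg (right_eq_mul.mp (hT.isPotential.eq_mul q'))

lemma finite_fixedPoints [Finite X] [Finite ↥Tᶜ] (hγ : Subgroup.closure (Set.range γ) = ⊤)
    (hg : g ≠ 1) : {v : V | g • v = v}.Finite := by
  obtain ⟨n, hn⟩ := exists_mem_ball hγ g
  refine (((ball_finite γ n).prod (Set.finite_univ (α := ↥Tᶜ))).image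
    fun q => q.1⁻¹ • q.2.1.1).subset fun v hv => ?_
  obtain ⟨m, hm, q⟩ := exists_walk_of_mem_ball hn v
  obtain ⟨e, ⟨-, he⟩, k, hk, h, r⟩ := hT.exists_exit (hv ▸ q : Walk γ _ v v m g) hg
  exact ⟨(h, ⟨e, he⟩), ⟨ball_mono (hk.trans hm) r.mem_ball, trivial⟩,
    inv_smul_eq_iff.mpr r.smul_eq.symm⟩

lemma exists_walk_shortEdges_le [Finite ↥Tᶜ] (hv : v ∈ shortVertices γ V M)
    (hu : Reachable γ (shortEdges γ V M) v u) :
    ∃ g, ∃ m ≤ Nat.card ↥Tᶜ * (2 * M + 1), Walk γ (shortEdges γ V M) v u m g := by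
  -- Every short vertex is within distance `M` of an edge outside `T`.
  refine exists_walk_le_of_near
    (fun w (e : ↥Tᶜ) => ∃ m ≤ M, ∃ h, Walk γ (shortEdges γ V M) w e.1.1 m h)
    (fun w hw => ?_) (fun w z e hw hz => ?_) hu
  · obtain ⟨g, hg, hne, hfix⟩ := hw.mem_shortVertices hv
    obtain ⟨n, hn, q⟩ := exists_walk_shortEdges hg hfix
    obtain ⟨e, ⟨-, he⟩, m, hm, r⟩ := hT.exists_exit q hne
    exact ⟨⟨e, he⟩, m, hm.trans hn, r⟩
  · obtain ⟨m, hm, h, q⟩ := hw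
    obtain ⟨k, hk, h', q'⟩ := hz
    exact ⟨_, by omega, _, q.trans q'.symm⟩

end IsSpanningTree

end ShortEdges

lemma closure_range_basis {ι G : Type*} [Group G] (b : FreeGroupBasis ι G) :
    Subgroup.closure (Set.range b) = ⊤ := by
  have hrange : Set.range b = b.repr.symm.toMonoidHom '' Set.range FreeGroup.of := by
    rw [← Set.range_comp]
    rfl
  rw [hrange, ← MonoidHom.map_closure, FreeGroup.closure_range_of, ← MonoidHom.range_eq_map,
    MonoidHom.range_eq_top]
  exact b.repr.symm.surjective

lemma smul_coset_one {G : Type*} [Group G] {H : Subgroup G} {g : G} :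
    g • ((1 : G) : G ⧸ H) = ((1 : G) : G ⧸ H) ↔ g ∈ H := by
  rw [← MulAction.mem_stabilizer_iff, MulAction.stabilizer_quotient]

section AdaptedBasis

variable {F G X V ι κ : Type*} [Group F] [Group G] [MulAction F V] {γ : X → F}
  {δ : FreeGroupBasis X F} {ψ : G →* F} {S : Set (V × X)} {M : ℕ}

/-- The edges `e` and `f` belong to the same connected component of the graph `S`. -/
def Linked (γ : X → F) (S : Set (V × X)) (e f : V × X) : Prop :=
  e ∈ S ∧ f ∈ S ∧ Reachable γ S e.1 f.1

lemma Linked.mono {S' : Set (V × X)} {e f : V × X} (h : Linked γ S e f) (hS : S ⊆ S') :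
    Linked γ S' e f :=
  ⟨hS h.1, hS h.2.1, h.2.2.mono hS⟩

lemma Linked.symm {e f : V × X} (h : Linked γ S e f) : Linked γ S f e := ⟨h.2.1, h.1, h.2.2.symm⟩

lemma Linked.trans {e f d : V × X} (h : Linked γ S e f) (h' : Linked γ S f d) : Linked γ S e d :=
  ⟨h.1, h'.2.1, h.2.2.trans h'.2.2⟩

/-- The subgroup generated by the part of a family `b`, usually a basis, that is related to `i`. The
relation `r` is usually a partial equivalence relation, with one block for each of its classes. -/
def block (b : ι → G) (r : ι → ι → Prop) (i : ι) : Subgroup G :=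
  Subgroup.closure (b '' {j | r i j})

lemma block_reindex (b : FreeGroupBasis ι G) (e : ι ≃ κ) (r : ι → ι → Prop) (k : κ) :
    block (b.reindex e) (fun i j => r (e.symm i) (e.symm j)) k = block b r (e.symm k) := by
  rw [block, block]
  congr 1
  ext g
  simp [e.exists_congr_left]

/-- Up to conjugacy, `K` is generated by elements of length at most `n`. -/
def ConjBounded (γ : X → F) (n : ℕ) (K : Subgroup F) : Prop :=
  ∃ s ⊆ ball γ n, Conjugate K (Subgroup.closure s)

/-- A basis `b` adapted to a homomorphism `ψ` to a group with generators `γ`. The blocks of `b` for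
`R M` are mapped by `ψ` to subgroups with short generators up to conjugacy, and they carry every
subgroup whose image has generators of length at most `M` up to conjugacy. -/
structure IsAdapted (γ : X → F) (ψ : G →* F) (b : ι → G) (R : ℕ → ι → ι → Prop) : Prop where
  mono : Monotone R
  symm {M i j} : R M i j → R M j i
  trans {M i j k} : R M i j → R M j k → R M i k
  bounded {M i} : R M i i →
    ConjBounded γ (2 * (Nat.card ι * (2 * M + 1)) + 1) ((block b (R M) i).map ψ)
  carries {M K} : K ≠ ⊥ → ConjBounded γ M (K.map ψ) →
    ∃ i, R M i i ∧ Subconjugate K (block b (R M) i)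

lemma IsAdapted.reindex {b : FreeGroupBasis ι G} {R : ℕ → ι → ι → Prop}
    (hb : IsAdapted γ ψ b R) (e : ι ≃ κ) :
    IsAdapted γ ψ (b.reindex e) fun M i j => R M (e.symm i) (e.symm j) where
  mono M N h i j := hb.mono h (e.symm i) (e.symm j)
  symm := hb.symm
  trans := hb.trans
  bounded h := by
    rw [block_reindex b e, ← Nat.card_congr e]
    exact hb.bounded h
  carries hK h := by
    obtain ⟨i, hi, hKi⟩ := hb.carries hK h
    refine ⟨e i, by simpa using hi, ?_⟩
    rwa [block_reindex b e, e.symm_apply_apply]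

namespace IsSpanningTree

variable {T : Set (V × X)} {p : V → F} {v₀ : V}

lemma loopGroup_eq_conjBy_map_block (hT : IsSpanningTree γ T v₀ p)
    (hS : ∀ u v, Reachable γ S u v → Reachable γ (T ∩ S) u v) {b : ↥Tᶜ → G}
    (hb : ∀ e, ψ (b e) = edgeLoop γ p e) {e : ↥Tᶜ} (he : e.1 ∈ S) {u : V}
    (hu : Reachable γ S u e.1.1) :
    loopGroup γ S u = conjBy (p u) ((block b (fun e f => Linked γ S e.1 f.1) e).map ψ) := by
  rw [hT.loopGroup_eq_conjBy hS, block, MonoidHom.map_closure, Set.image_image]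
  congr 2
  ext g
  simp only [hb]
  constructor
  · rintro ⟨f, ⟨⟨hf, huf⟩, hfT⟩, rfl⟩
    exact ⟨⟨f, hfT⟩, ⟨he, hf, hu.symm.trans huf⟩, rfl⟩
  · rintro ⟨f, ⟨-, hf, hef⟩, rfl⟩
    exact ⟨f, ⟨⟨hf, hu.trans hef⟩, f.2⟩, rfl⟩

variable {T : Set ((F ⧸ ψ.range) × X)} {p : F ⧸ ψ.range → F}

theorem isAdapted [Finite ↥Tᶜ] (hT : IsSpanningTree γ T ((1 : F) : F ⧸ ψ.range) p)
    (hψ : Function.Injective ψ)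
    (hS : ∀ M u v, Reachable γ (shortEdges γ _ M) u v → Reachable γ (T ∩ shortEdges γ _ M) u v)
    {b : ↥Tᶜ → G} (hb : ∀ e, ψ (b e) = edgeLoop γ p e) :
    IsAdapted γ ψ b fun M e f => Linked γ (shortEdges γ _ M) e.1 f.1 where
  mono _ _ h _ _ hef := hef.mono (monotone_shortEdges h)
  symm := Linked.symm
  trans := Linked.trans
  bounded {M e} he := by
    have h := hT.loopGroup_eq_conjBy_map_block (hS M) hb he.1 (Reachable.refl _)
    rw [loopGroup_eq_closure_ball fun u hu => hT.exists_walk_shortEdges_le he.1.1 hu] at h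
    exact ⟨_, Set.inter_subset_right, Conjugate.symm ⟨_, h⟩⟩
  carries {M K} hK := by
    rintro ⟨s, hs, y, hy⟩
    have hstab (g : F) (hg : g ∈ s) : g • y⁻¹ • ((1 : F) : F ⧸ ψ.range) = y⁻¹ • ((1 : F) : _) := by
      have hmem : y * g * y⁻¹ ∈ K.map ψ := by
        rw [hy, mem_conjBy]
        simpa [mul_assoc] using Subgroup.subset_closure hg
      rw [eq_inv_smul_iff, ← mul_smul, ← mul_smul, smul_coset_one]
      exact Subgroup.map_le_range ψ K hmem
    have hloop (g : F) (hg : g ∈ s) := exists_walk_shortEdges (hs hg) (hstab g hg)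
    obtain ⟨g, hg, hne⟩ : ∃ g ∈ s, g ≠ 1 := by
      by_contra! h
      rw [Subgroup.closure_eq_bot_iff.mpr h, conjBy, Subgroup.map_bot] at hy
      exact hK ((Subgroup.map_eq_bot_iff_of_injective K hψ).mp hy)
    obtain ⟨n, -, q⟩ := hloop g hg
    obtain ⟨e, ⟨he, heT⟩, m, -, h, r⟩ := hT.exists_exit q hne
    obtain ⟨z, hz⟩ : y * p (y⁻¹ • ((1 : F) : F ⧸ ψ.range)) ∈ ψ.range := by
      rw [← smul_coset_one, mul_smul, hT.smul_eq, smul_inv_smul]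
    refine ⟨⟨e, heT⟩, ⟨he, he, .refl _⟩, z, ?_⟩
    rw [← Subgroup.map_le_map_iff_of_injective hψ, map_conjBy, hz, hy, ← conjBy_conjBy,
      ← hT.loopGroup_eq_conjBy_map_block (hS M) hb he ⟨m, h, r⟩]
    refine conjBy_mono y ((Subgroup.closure_le _).mpr fun g hg => ?_)
    exact (hloop g hg).imp fun _ h => h.2

end IsSpanningTree

lemma exists_basis_of_isSpanningTree (hψ : Function.Injective ψ) {T : Set ((F ⧸ ψ.range) × X)}
    {p : F ⧸ ψ.range → F} (hT : IsSpanningTree δ T ((1 : F) : F ⧸ ψ.range) p) :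
    ∃ b : FreeGroupBasis ↥Tᶜ G, ∀ e, ψ (b e) = edgeLoop δ p e := by
  have hrange : (FreeGroup.lift fun e : ↥Tᶜ => edgeLoop δ p e).range = ψ.range := by
    rw [FreeGroup.range_lift_eq_closure, ← Set.image_eq_range,
      hT.closure_edgeLoop_eq_stabilizer (closure_range_basis δ), MulAction.stabilizer_quotient]
  let f : FreeGroup ↥Tᶜ ≃* G := (MonoidHom.ofInjective hT.lift_edgeLoop_injective).trans
    ((MulEquiv.subgroupCongr hrange).trans (MonoidHom.ofInjective hψ).symm)
  refine ⟨⟨f.symm⟩, fun e => ?_⟩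
  change ψ ((MonoidHom.ofInjective hψ).symm _) = _
  rw [← MonoidHom.ofInjective_apply hψ, MulEquiv.apply_symm_apply]
  simp [MonoidHom.ofInjective_apply]

lemma exists_isSpanningTree_cosets (δ : FreeGroupBasis X F) (hψ : Function.Injective ψ) :
    ∃ (T : Set ((F ⧸ ψ.range) × X)) (p : F ⧸ ψ.range → F) (b : FreeGroupBasis ↥Tᶜ G),
      IsSpanningTree δ T ((1 : F) : F ⧸ ψ.range) p ∧
      (∀ M u v, Reachable δ (shortEdges δ _ M) u v → Reachable δ (T ∩ shortEdges δ _ M) u v) ∧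
      ∀ e, ψ (b e) = edgeLoop δ p e := by
  obtain ⟨T, p, hT, hS⟩ := exists_isSpanningTree (closure_range_basis δ)
    (monotone_shortEdges (γ := δ) (V := F ⧸ ψ.range)) ((1 : F) : F ⧸ ψ.range)
  obtain ⟨b, hb⟩ := exists_basis_of_isSpanningTree hψ hT
  exact ⟨T, p, b, hT, hS, hb⟩

theorem exists_isAdapted [Finite ι] (β : FreeGroupBasis ι G) (δ : FreeGroupBasis X F)
    (hψ : Function.Injective ψ) :
    ∃ (b : FreeGroupBasis ι G) (R : ℕ → ι → ι → Prop), IsAdapted δ ψ b R := by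
  obtain ⟨T, p, b, hT, hS, hb⟩ := exists_isSpanningTree_cosets δ hψ
  let e : ↥Tᶜ ≃ ι := Equiv.ofFreeGroupEquiv (b.repr.symm.trans β.repr)
  have : Finite ↥Tᶜ := .of_equiv ι e.symm
  exact ⟨b.reindex e, _, (hT.isAdapted hψ hS hb).reindex e⟩

lemma finite_fixed_cosets [Finite X] [Finite ι] (β : FreeGroupBasis ι G) (δ : FreeGroupBasis X F)
    (hψ : Function.Injective ψ) {g : F} (hg : g ≠ 1) : {v : F ⧸ ψ.range | g • v = v}.Finite := by
  obtain ⟨T, p, b, hT, -⟩ := exists_isSpanningTree_cosets δ hψ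
  have : Finite ↥Tᶜ := .of_equiv ι (Equiv.ofFreeGroupEquiv (b.repr.symm.trans β.repr)).symm
  exact hT.finite_fixedPoints (closure_range_basis δ) hg

end AdaptedBasis

section FreeFactors

variable {ι κ F G : Type*} [Group F] [Group G]

lemma finite_of_basis_of_fg [Group.FG F] (b : FreeGroupBasis ι F) : Finite ι := by
  classical
  -- `F` has only finitely many homomorphisms to the group of order two.
  obtain ⟨s, hs⟩ := Group.FG.out (G := F)
  have : Finite (Multiplicative (ZMod 2)) := inferInstanceAs (Finite (ZMod 2))
  have hrestrict : Function.Injective fun (f : F →* Multiplicative (ZMod 2)) (g : s) => f g :=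
    fun f g h => MonoidHom.eq_of_eqOn_dense hs fun a ha => congrFun h ⟨a, ha⟩
  have : Finite (F →* Multiplicative (ZMod 2)) := .of_injective _ hrestrict
  have : Finite (ι → Multiplicative (ZMod 2)) := .of_equiv _ b.lift.symm
  let indicator (i : ι) : ι → Multiplicative (ZMod 2) := Pi.mulSingle i (Multiplicative.ofAdd 1)
  refine .of_injective indicator fun i j h => ?_
  by_contra hij
  have heval : indicator i i = indicator j i := congrFun h i
  simp only [indicator, Pi.mulSingle_eq_same, Pi.mulSingle_eq_of_ne hij] at heval
  exact one_ne_zero (Multiplicative.ofAdd.injective heval)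

lemma basis_ne_one (b : FreeGroupBasis ι F) (i : ι) : b i ≠ 1 := by
  rw [← (map_ne_one_iff _ b.repr.injective), b.repr_apply_coe]
  exact FreeGroup.of_ne_one i

lemma hom_ext_of_eq_closure {A : Subgroup F} {t : Set F} (hA : A = Subgroup.closure t)
    {f g : A →* G} (h : ∀ a (ha : a ∈ A), a ∈ t → f ⟨a, ha⟩ = g ⟨a, ha⟩) : f = g := by
  subst hA
  exact MonoidHom.eq_of_eqOn_dense Subgroup.closure_closure_coe_preimage
    fun a ha => h a a.2 ha

lemma coprodI_lift_injective_of_basis (b : FreeGroupBasis ι F) {A : κ → Subgroup F} {U : κ → Set ι}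
    (hA : ∀ k, A k = Subgroup.closure (b '' U k)) (hU : Pairwise fun k l => Disjoint (U k) (U l)) :
    Function.Injective (Monoid.CoprodI.lift fun k => (A k).subtype) := by
  have hmem (k : κ) (i : ι) (hi : i ∈ U k) : b i ∈ A k :=
    hA k ▸ Subgroup.subset_closure ⟨i, hi, rfl⟩
  have hexists (i : ι) : ∃ y : Monoid.CoprodI fun k => A k,
      ∀ k (hi : i ∈ U k), y = Monoid.CoprodI.of ⟨b i, hmem k i hi⟩ := by
    by_cases h : ∃ k, i ∈ U k
    · obtain ⟨k, hk⟩ := h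
      refine ⟨Monoid.CoprodI.of ⟨b i, hmem k i hk⟩, fun l hl => ?_⟩
      obtain rfl : k = l := hU.eq (Set.not_disjoint_iff.mpr ⟨i, hk, hl⟩)
      rfl
    · exact ⟨1, fun k hk => absurd ⟨k, hk⟩ h⟩
  choose y hy using hexists
  have hy' (i : ι) : b.lift y (b i) = y i := congrFun (b.lift.symm_apply_apply y) i
  have hinv : (b.lift y).comp (Monoid.CoprodI.lift fun k => (A k).subtype) = MonoidHom.id _ := by
    refine Monoid.CoprodI.ext_hom _ _ fun k => hom_ext_of_eq_closure (hA k) ?_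
    rintro _ ha ⟨i, hi, rfl⟩
    simp [hy', hy i k hi]
  exact Function.LeftInverse.injective (g := b.lift y) (DFunLike.congr_fun hinv)

lemma coprod_lift_injective_of_basis (b : FreeGroupBasis ι F) (U : Set ι) :
    Function.Injective (Monoid.Coprod.lift (Subgroup.closure (b '' U)).subtype
      (Subgroup.closure (b '' Uᶜ)).subtype) := by
  classical
  let y (i : ι) : Monoid.Coprod (Subgroup.closure (b '' U)) (Subgroup.closure (b '' Uᶜ)) :=
    if h : i ∈ U then Monoid.Coprod.inl ⟨b i, Subgroup.subset_closure ⟨i, h, rfl⟩⟩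
    else Monoid.Coprod.inr ⟨b i, Subgroup.subset_closure ⟨i, h, rfl⟩⟩
  have hy (i : ι) : b.lift y (b i) = y i := congrFun (b.lift.symm_apply_apply y) i
  have hinv : (b.lift y).comp (Monoid.Coprod.lift (Subgroup.closure (b '' U)).subtype
      (Subgroup.closure (b '' Uᶜ)).subtype) = MonoidHom.id _ := by
    apply Monoid.Coprod.hom_ext <;> refine hom_ext_of_eq_closure rfl ?_
    · rintro _ ha ⟨i, hi, rfl⟩
      simp [hy, y, hi]
    · rintro _ ha ⟨i, hi, rfl⟩
      simp [hy, y, show i ∉ U from hi]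
  exact Function.LeftInverse.injective (g := b.lift y) (DFunLike.congr_fun hinv)

lemma isFreeFactor_closure_basis (b : FreeGroupBasis ι F) (U : Set ι) :
    IsFreeFactor (Subgroup.closure (b '' U)) := by
  refine ⟨Subgroup.closure (b '' Uᶜ), coprod_lift_injective_of_basis b U, ?_⟩
  rw [← MonoidHom.range_eq_top, Monoid.Coprod.range_lift, Subgroup.range_subtype,
    Subgroup.range_subtype, ← Subgroup.closure_union, ← Set.image_union, Set.union_compl_self,
    Set.image_univ, closure_range_basis]

lemma isNontrivialFreeFactorSystem_of_basis (b : FreeGroupBasis ι F) {𝒜 : Finset (Subgroup F)}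
    (h𝒜 : 𝒜.Nonempty) {U : 𝒜 → Set ι}
    (hU : ∀ A : 𝒜, (A : Subgroup F) = Subgroup.closure (b '' U A))
    (hne : ∀ A, (U A).Nonempty) (hdisj : Pairwise fun A B => Disjoint (U A) (U B)) :
    IsNontrivialFreeFactorSystem 𝒜 := by
  refine ⟨h𝒜, fun A hA hbot => ?_, coprodI_lift_injective_of_basis b hU hdisj, ?_⟩
  · obtain ⟨i, hi⟩ := hne ⟨A, hA⟩
    have htriv := (hU ⟨A, hA⟩).symm.trans hbot
    exact basis_ne_one b i (Subgroup.closure_eq_bot_iff.mp htriv ⟨i, hi, rfl⟩)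
  · have hsup : (⨆ A ∈ 𝒜, A) = Subgroup.closure (b '' ⋃ A, U A) := by
      rw [Set.image_iUnion, Subgroup.closure_iUnion, iSup_subtype']
      exact iSup_congr hU
    exact hsup ▸ isFreeFactor_closure_basis b _

lemma isFreeFactorSystem_image_block [DecidableEq (Subgroup F)] [Fintype κ] [Nonempty κ]
    (b : FreeGroupBasis ι F) {r : ι → ι → Prop} (hsymm : ∀ i j, r i j → r j i)
    (htrans : ∀ i j k, r i j → r j k → r i k) {i : κ → ι} (hi : ∀ k, r (i k) (i k)) :
    IsFreeFactorSystem (Finset.univ.image fun k => block b r (i k)) := by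
  have hindex (A : Finset.univ.image fun k => block b r (i k)) :
      ∃ k, block b r (i k) = (A : Subgroup F) := by
    simpa only [Finset.mem_image, Finset.mem_univ, true_and] using A.2
  choose k hk using hindex
  refine .inr (isNontrivialFreeFactorSystem_of_basis b (Finset.univ_nonempty.image _)
    (fun A => (hk A).symm) (fun A => ⟨_, hi (k A)⟩) fun A B hAB => ?_)
  refine Set.disjoint_left.mpr fun j hA hB => hAB (Subtype.ext ?_)
  have h : r (i (k A)) (i (k B)) := htrans _ _ _ hA (hsymm _ _ hB)
  have hrel : r (i (k A)) = r (i (k B)) :=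
    funext fun l => propext ⟨htrans _ _ l (hsymm _ _ h), htrans _ _ l h⟩
  rw [← hk A, ← hk B, block, block, hrel]

lemma group_fg_coprodI_component {A : κ → Type*} [∀ k, Group (A k)]
    [Group.FG (Monoid.CoprodI A)] (k : κ) : Group.FG (A k) := by
  classical
  refine Group.fg_of_surjective
    (f := Monoid.CoprodI.lift (Pi.mulSingle k (MonoidHom.id (A k)))) fun a => ?_
  exact ⟨Monoid.CoprodI.of a, by simp⟩

lemma IsFreeFactor.fg [Group.FG F] {A : Subgroup F} (hA : IsFreeFactor A) : A.FG := by
  obtain ⟨B, hB⟩ := hA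
  rw [← Group.fg_iff_subgroup_fg]
  exact Group.fg_of_surjective
    (f := Monoid.Coprod.fst.comp (MulEquiv.ofBijective _ hB).symm.toMonoidHom)
    (Monoid.Coprod.fst_surjective.comp (MulEquiv.ofBijective _ hB).symm.surjective)

lemma IsNontrivialFreeFactorSystem.isFG [Group.FG F] {𝒜 : Finset (Subgroup F)}
    (h𝒜 : IsNontrivialFreeFactorSystem 𝒜) : IsFG 𝒜 := by
  obtain ⟨-, -, hinj, hfactor⟩ := h𝒜
  have hrange : (Monoid.CoprodI.lift fun A : 𝒜 => (A : Subgroup F).subtype).range =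
      ⨆ A ∈ 𝒜, A := by
    rw [Monoid.CoprodI.range_eq_iSup, iSup_subtype']
    simp only [Subgroup.range_subtype]
  have hfg := hfactor.fg
  rw [← hrange, ← Group.fg_iff_subgroup_fg] at hfg
  have : Group.FG (Monoid.CoprodI fun A : 𝒜 => (A : Subgroup F)) :=
    Group.fg_of_surjective (f := (MonoidHom.ofInjective hinj).symm.toMonoidHom)
      (MonoidHom.ofInjective hinj).symm.surjective
  intro A hA
  rw [← Group.fg_iff_subgroup_fg]
  exact group_fg_coprodI_component (A := fun A : 𝒜 => (A : Subgroup F)) ⟨A, hA⟩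

lemma IsFreeFactorSystem.isFG [Group.FG F] {𝒜 : Finset (Subgroup F)}
    (h𝒜 : IsFreeFactorSystem 𝒜) : IsFG 𝒜 := by
  rcases h𝒜 with rfl | h
  · exact fun A hA => Finset.mem_singleton.mp hA ▸ Subgroup.FG.bot
  · exact h.isFG

end FreeFactors

section Subconjugation

variable {F G : Type*} [Group F] [IsFreeGroup F] [Group.FG F] [Group G] {A B : Subgroup F}
  {x g : F}

lemma finite_fixed_cosets_of_fg (hB : B.FG) (hg : g ≠ 1) : {v : F ⧸ B | g • v = v}.Finite := by
  have : IsFreeGroup B := subgroupIsFreeOfIsFree B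
  have : Group.FG B := (Group.fg_iff_subgroup_fg B).mpr hB
  have := finite_of_basis_of_fg (IsFreeGroup.basis F)
  have := finite_of_basis_of_fg (IsFreeGroup.basis B)
  have hfin := finite_fixed_cosets (IsFreeGroup.basis B) (IsFreeGroup.basis F)
    B.subtype_injective hg
  rwa [Subgroup.range_subtype] at hfin

omit [IsFreeGroup F] [Group.FG F] in
lemma le_conjBy_pow (h : B ≤ conjBy x B) (n : ℕ) : B ≤ conjBy (x ^ n) B := by
  induction n with
  | zero => simp
  | succ n ih =>
    rw [pow_succ', ← conjBy_conjBy]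
    exact h.trans (conjBy_mono x ih)

lemma exists_pow_mem_of_le_conjBy (hB : B.FG) (hne : B ≠ ⊥) (h : B ≤ conjBy x B) :
    ∃ d : ℕ, x ^ (d + 1) ∈ B := by
  obtain ⟨g, hg, hg1⟩ := B.bot_or_exists_ne_one.resolve_left hne
  have hfixed (n : ℕ) : g • ((x ^ n : F) : F ⧸ B) = ((x ^ n : F) : F ⧸ B) := by
    have hgn := mem_conjBy.mp (le_conjBy_pow h n hg)
    rw [mul_assoc, ← QuotientGroup.eq] at hgn
    exact hgn.symm
  obtain ⟨m, n, hmn, heq⟩ :=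
    (finite_fixed_cosets_of_fg hB hg1).exists_lt_map_eq_of_forall_mem hfixed
  obtain ⟨d, rfl⟩ := Nat.exists_eq_add_of_lt hmn
  refine ⟨d, ?_⟩
  rw [QuotientGroup.eq] at heq
  simpa [pow_add, add_assoc] using heq

lemma eq_conjBy_of_le (hB : B.FG) (h : B ≤ conjBy x B) : B = conjBy x B := by
  by_cases hne : B = ⊥
  · rw [hne, conjBy, Subgroup.map_bot]
  obtain ⟨d, hd⟩ := exists_pow_mem_of_le_conjBy hB hne h
  have hpow : conjBy x B ≤ conjBy (x ^ (d + 1)) B := by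
    rw [pow_succ', ← conjBy_conjBy]
    exact conjBy_mono x (le_conjBy_pow h d)
  refine le_antisymm h (hpow.trans fun a ha => ?_)
  simpa [mul_assoc] using mul_mem (mul_mem hd (mem_conjBy.mp ha)) (inv_mem hd)

lemma eq_of_le_of_subconjugate (hA : A.FG) (h : A ≤ B) (h' : Subconjugate B A) : A = B := by
  obtain ⟨z, hz⟩ := h'
  exact le_antisymm h (hz.trans (eq_conjBy_of_le hA (h.trans hz)).ge)

lemma Conjugate.of_map_subconjugate {K L : Subgroup G} {ψ : G →* F} (hψ : Function.Injective ψ)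
    (hK : (K.map ψ).FG) (h : Subconjugate K L) (h' : Subconjugate (L.map ψ) (K.map ψ)) :
    Conjugate K L := by
  obtain ⟨x, hx⟩ := h
  refine ⟨x, Subgroup.map_injective hψ (eq_of_le_of_subconjugate hK (Subgroup.map_mono hx) ?_)⟩
  exact .trans ⟨ψ x, (map_conjBy ψ x L).le⟩ h'

lemma Subconjugate.antisymm (hA : A.FG) (h : Subconjugate A B) (h' : Subconjugate B A) :
    Conjugate A B := by
  have hmap (K : Subgroup F) : K.map (MonoidHom.id F) = K := Subgroup.map_id K
  exact .of_map_subconjugate (ψ := MonoidHom.id F) Function.injective_id (by rwa [hmap]) h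
    (by rwa [hmap, hmap])

end Subconjugation

section Limit

open Filter

variable {F G X ι ν : Type*} [Group F] [Group G]

/-- A limit of bases `b n` along an ultrafilter. The blocks of `b n` for the partial equivalence
relation `r` are mapped by `ψ n` to fixed subgroups `B i`, up to conjugacy, and they carry every
subgroup that is mapped to a given finitely generated subgroup up to conjugacy. -/
structure IsLimitSystem (U : Ultrafilter ν) (ψ : ν → G →* F) (b : ν → FreeGroupBasis ι G)
    (r : ι → ι → Prop) (B : ι → Subgroup F) : Prop where
  symm i j : r i j → r j i
  trans i j k : r i j → r j k → r i k
  fg i : (B i).FG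
  conjugate : ∀ᶠ n in U, ∀ i, r i i → Conjugate ((block (b n) r i).map (ψ n)) (B i)
  carries {C} : C ≠ ⊥ → C.FG → ∀ᶠ n in U, ∀ K, Conjugate (K.map (ψ n)) C →
    ∃ i, r i i ∧ Subconjugate K (block (b n) r i)

lemma exists_stable_limit [Finite ι] (U : Ultrafilter ν) {R : ν → ℕ → ι → ι → Prop}
    (hR : ∀ n, Monotone (R n)) :
    ∃ (M₀ : ℕ) (r : ι → ι → Prop), ∀ M ≥ M₀, ∀ᶠ n in U, R n M = r := by
  have hlim (M : ℕ) : ∃ r, ∀ᶠ n in U, R n M = r :=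
    Ultrafilter.eventually_exists_iff.mp (.of_forall fun n => ⟨R n M, rfl⟩)
  choose r hr using hlim
  have hmono : Monotone r := fun M N hMN => by
    obtain ⟨n, hM, hN⟩ := ((hr M).and (hr N)).exists
    exact hM ▸ hN ▸ hR n hMN
  obtain ⟨M₀, hM₀⟩ := WellFoundedGT.monotone_chain_condition ⟨r, hmono⟩
  refine ⟨M₀, r M₀, fun M hM => ?_⟩
  have hstable : r M₀ = r M := hM₀ M hM
  exact hstable ▸ hr M

lemma exists_limit_of_conjBounded [Finite X] {γ : X → F} {D : ℕ} {U : Ultrafilter ν}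
    {K : ν → Subgroup F} (hK : ∀ᶠ n in U, ConjBounded γ D (K n)) :
    ∃ C : Subgroup F, C.FG ∧ ∀ᶠ n in U, Conjugate (K n) C := by
  obtain ⟨s, hs, hconj⟩ :=
    (Ultrafilter.eventually_exists_mem_iff (ball_finite γ D).finite_subsets).mp hK
  exact ⟨_, (Subgroup.fg_iff _).mpr ⟨s, rfl, (ball_finite γ D).subset hs⟩, hconj⟩

theorem exists_isLimitSystem [Finite X] [Finite ι] (δ : FreeGroupBasis X F) (U : Ultrafilter ν)
    {ψ : ν → G →* F} {b : ν → FreeGroupBasis ι G} {R : ν → ℕ → ι → ι → Prop}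
    (hb : ∀ n, IsAdapted δ (ψ n) (b n) (R n)) : ∃ r B, IsLimitSystem U ψ b r B := by
  obtain ⟨M₀, r, hr⟩ := exists_stable_limit U fun n => (hb n).mono
  have hlim (i : ι) : ∃ C : Subgroup F, C.FG ∧
      (r i i → ∀ᶠ n in U, Conjugate ((block (b n) r i).map (ψ n)) C) := by
    by_cases hi : r i i
    · have hbounded : ∀ᶠ n in U, ConjBounded δ (2 * (Nat.card ι * (2 * M₀ + 1)) + 1)
          ((block (b n) r i).map (ψ n)) := by
        filter_upwards [hr M₀ le_rfl] with n hn
        subst hn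
        exact (hb n).bounded hi
      obtain ⟨C, hC, h⟩ := exists_limit_of_conjBounded hbounded
      exact ⟨C, hC, fun _ => h⟩
    · exact ⟨⊥, Subgroup.FG.bot, fun h => absurd h hi⟩
  choose B hfg hB using hlim
  obtain ⟨n₀, rfl⟩ := (hr M₀ le_rfl).exists
  refine ⟨R n₀ M₀, B, fun _ _ => (hb n₀).symm, fun _ _ _ => (hb n₀).trans, hfg, ?_, ?_⟩
  · exact eventually_all.mpr fun i => eventually_imp_distrib_left.mpr (hB i)
  · intro C hne hC
    obtain ⟨s, rfl, hs⟩ := (Subgroup.fg_iff C).mp hC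
    obtain ⟨M, hM⟩ := exists_subset_ball (closure_range_basis δ) hs
    filter_upwards [hr (max M₀ M) (le_max_left _ _)] with n hn K hK
    refine hn ▸ (hb n).carries ?_ ⟨s, hM.trans (ball_mono (le_max_right _ _)), hK⟩
    rintro rfl
    exact hK.ne_bot hne (Subgroup.map_bot (ψ n))

lemma IsLimitSystem.ne_bot {U : Ultrafilter ν} {ψ : ν → G →* F} {b : ν → FreeGroupBasis ι G}
    {r : ι → ι → Prop} {B : ι → Subgroup F} (hB : IsLimitSystem U ψ b r B)
    (hψ : ∀ n, Function.Injective (ψ n)) {i : ι} (hi : r i i) : B i ≠ ⊥ := by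
  obtain ⟨n, hn⟩ := hB.conjugate.exists
  refine (hn i hi).symm.ne_bot fun hbot => ?_
  rw [Subgroup.map_eq_bot_iff_of_injective _ (hψ n), block, Subgroup.closure_eq_bot_iff] at hbot
  exact basis_ne_one (b n) i (hbot ⟨i, hi, rfl⟩)

end Limit

section Tails

variable {F κ : Type*} [Group F] {φ : F →* F} {K : Subgroup F}

/-- The `n`-th iterate of an endomorphism, as a homomorphism. -/
def iter (φ : F →* F) : ℕ → F →* F
  | 0 => MonoidHom.id F
  | n + 1 => φ.comp (iter φ n)

lemma iter_apply (φ : F →* F) (n : ℕ) (g : F) : iter φ n g = φ^[n] g := by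
  induction n with
  | zero => rfl
  | succ n ih => rw [Function.iterate_succ_apply', ← ih, iter, MonoidHom.comp_apply]

lemma iter_injective (hφ : Function.Injective φ) (n : ℕ) : Function.Injective (iter φ n) := by
  rw [funext (iter_apply φ n)]
  exact hφ.iterate n

lemma map_iter_zero (φ : F →* F) (K : Subgroup F) : K.map (iter φ 0) = K := K.map_id

lemma map_iter_succ (φ : F →* F) (n : ℕ) (K : Subgroup F) :
    K.map (iter φ (n + 1)) = (K.map (iter φ n)).map φ := by
  rw [Subgroup.map_map, iter]

lemma map_iter_add (φ : F →* F) (m n : ℕ) (K : Subgroup F) :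
    K.map (iter φ (m + n)) = (K.map (iter φ n)).map (iter φ m) := by
  rw [Subgroup.map_map]
  congr 1
  ext g
  simp only [MonoidHom.comp_apply, iter_apply, Function.iterate_add_apply]

lemma conjugate_map_iter {A : κ → Subgroup F} {σ : Equiv.Perm κ}
    (h : ∀ k, Conjugate ((A k).map φ) (A (σ k))) (n : ℕ) (k : κ) :
    Conjugate ((A k).map (iter φ n)) (A ((σ ^ n) k)) := by
  induction n with
  | zero =>
    rw [map_iter_zero]
    exact .refl _
  | succ n ih =>
    rw [map_iter_succ, pow_succ']
    exact (ih.map φ).trans (h _)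

/-- The conjugacy class of the subgroup `K` has an infinite tail under `φ`, as in
`HasInfiniteTail`. -/
def SubgroupTail (φ : F →* F) (K : Subgroup F) : Prop :=
  ∀ n, ∃ L : Subgroup F, Conjugate (L.map (iter φ n)) K

lemma SubgroupTail.map (h : SubgroupTail φ K) : SubgroupTail φ (K.map φ) := by
  intro n
  obtain ⟨L, hL⟩ := h n
  refine ⟨L.map φ, ?_⟩
  have hcomm : (L.map φ).map (iter φ n) = (L.map (iter φ n)).map φ := by
    rw [← map_iter_succ, map_iter_add, map_iter_succ, map_iter_zero]
  exact hcomm ▸ hL.map φ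

lemma subgroupTail_of_frequently
    (h : ∃ᶠ n in Filter.atTop, ∃ L : Subgroup F, Conjugate (L.map (iter φ n)) K) :
    SubgroupTail φ K := by
  intro n
  obtain ⟨m, hnm, L, hL⟩ := Filter.frequently_atTop.mp h n
  refine ⟨L.map (iter φ (m - n)), ?_⟩
  rwa [← map_iter_add, Nat.add_sub_cancel' hnm]

lemma HasInfiniteTail.subgroupTail {g : F} (h : HasInfiniteTail φ g) :
    SubgroupTail φ (Subgroup.zpowers g) := by
  refine subgroupTail_of_frequently ((Filter.eventually_ge_atTop 1).frequently.mono fun n hn => ?_)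
  obtain ⟨a, ha⟩ := h n hn
  obtain ⟨x, hx⟩ := isConj_iff.mp ha
  refine ⟨Subgroup.zpowers a, Conjugate.symm ⟨x, ?_⟩⟩
  rw [MonoidHom.map_zpowers, iter_apply, conjBy, MonoidHom.map_zpowers, ← hx]
  rfl

lemma IsFixed.subgroupTail {ℬ : Finset (Subgroup F)} (h : IsFixed φ ℬ) (hK : K ∈ ℬ) :
    SubgroupTail φ K := by
  obtain ⟨σ, hσ⟩ := h
  intro n
  refine ⟨((σ ^ n)⁻¹ ⟨K, hK⟩ : ℬ), ?_⟩
  simpa using conjugate_map_iter hσ n ((σ ^ n)⁻¹ ⟨K, hK⟩)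

variable [IsFreeGroup F] [Group.FG F]

lemma finite_fixed_cosets_range (φ : F →* F) {g : F} (hg : g ≠ 1) :
    {v : F ⧸ φ.range | g • v = v}.Finite :=
  finite_fixed_cosets_of_fg ((Group.fg_iff_subgroup_fg _).mp (Group.fg_range φ)) hg

lemma SubgroupTail.exists_preimage (h : SubgroupTail φ K) (hφ : Function.Injective φ)
    (hK : K ≠ ⊥) : ∃ L : Subgroup F, SubgroupTail φ L ∧ Conjugate (L.map φ) K := by
  obtain ⟨g, hg, hg1⟩ := K.bot_or_exists_ne_one.resolve_left hK
  choose L y hL using fun n : ℕ => h (n + 1)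
  simp only [map_iter_succ] at hL
  have hfixed (n : ℕ) : g • (((y n)⁻¹ : F) : F ⧸ φ.range) = (((y n)⁻¹ : F) : F ⧸ φ.range) := by
    have hmem : y n * g * (y n)⁻¹ ∈ ((L n).map (iter φ n)).map φ := by
      rw [hL, mem_conjBy]
      simpa [mul_assoc] using hg
    refine (QuotientGroup.eq.mpr ?_).symm
    simpa [mul_assoc] using Subgroup.map_le_range φ _ hmem
  -- The `y n` represent the same coset for infinitely many `n`, so the `L n` have conjugate images.
  obtain ⟨v, -, hv⟩ : ∃ v ∈ {v : F ⧸ φ.range | g • v = v},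
      ∃ᶠ n in Filter.atTop, (((y n)⁻¹ : F) : F ⧸ φ.range) = v :=
    (Filter.frequently_exists_finite (finite_fixed_cosets_range φ hg1)).mp
      (.of_forall fun n => ⟨_, hfixed n, rfl⟩)
  obtain ⟨m, hm⟩ := hv.exists
  refine ⟨(L m).map (iter φ m), subgroupTail_of_frequently ?_, y m, hL m⟩
  refine hv.mono fun n hn => ⟨L n, ?_⟩
  have hnm := hn.trans hm.symm
  rw [QuotientGroup.eq, inv_inv] at hnm
  obtain ⟨a, ha⟩ := hnm
  refine ⟨a, Subgroup.map_injective hφ ?_⟩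
  rw [map_conjBy, hL, hL, conjBy_conjBy, ha, inv_mul_cancel_right]

end Tails

section TailCore

variable {F κ : Type*} [Group F] {φ : F →* F}

/-- Representatives, up to conjugacy, of the maximal finitely generated nontrivial subgroups with an
infinite tail. -/
structure IsTailCore (φ : F →* F) (A : κ → Subgroup F) : Prop where
  fg k : (A k).FG
  ne_bot k : A k ≠ ⊥
  tail k : SubgroupTail φ (A k)
  antichain {k l} : Subconjugate (A k) (A l) → k = l
  cofinal {K} : K ≠ ⊥ → K.FG → SubgroupTail φ K → ∃ k, Subconjugate K (A k)

lemma exists_cofinal_antichain {α : Type*} (D : Finset α) {r : α → α → Prop} (hrefl : ∀ a, r a a)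
    (htrans : ∀ a b c, r a b → r b c → r a c) :
    ∃ Q ⊆ D, (∀ a ∈ D, ∃ q ∈ Q, r a q) ∧ ∀ p ∈ Q, ∀ q ∈ Q, r p q → p = q := by
  classical
  let IsCofinal (Q : Finset α) : Prop := ∀ a ∈ D, ∃ q ∈ Q, r a q
  -- A cofinal subset of minimal cardinality is an antichain.
  obtain ⟨Q, hQ, hmin⟩ := (D.powerset.filter IsCofinal).exists_min_image Finset.card
    ⟨D, Finset.mem_filter.mpr ⟨D.mem_powerset_self, fun a ha => ⟨a, ha, hrefl a⟩⟩⟩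
  obtain ⟨hQD, hcof⟩ := Finset.mem_filter.mp hQ
  rw [Finset.mem_powerset] at hQD
  refine ⟨Q, hQD, hcof, fun p hp q hq hpq => ?_⟩
  by_contra hne
  have herase : IsCofinal (Q.erase p) := fun a ha => by
    obtain ⟨c, hc, hac⟩ := hcof a ha
    obtain rfl | hcp := eq_or_ne c p
    · exact ⟨q, Finset.mem_erase.mpr ⟨Ne.symm hne, hq⟩, htrans _ _ _ hac hpq⟩
    · exact ⟨c, Finset.mem_erase.mpr ⟨hcp, hc⟩, hac⟩
  have hsub : Q.erase p ∈ D.powerset.filter IsCofinal := Finset.mem_filter.mpr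
    ⟨Finset.mem_powerset.mpr ((Finset.erase_subset p Q).trans hQD), herase⟩
  exact (Finset.card_erase_lt_of_mem hp).not_ge (hmin _ hsub)

theorem IsTailCore.exists_perm [IsFreeGroup F] [Group.FG F] [Finite κ] {A : κ → Subgroup F}
    (hA : IsTailCore φ A) (hφ : Function.Injective φ) :
    ∃ σ : Equiv.Perm κ, ∀ k, Conjugate ((A k).map φ) (A (σ k)) := by
  have himage (k : κ) : ∃ l, Subconjugate ((A k).map φ) (A l) :=
    hA.cofinal ((Subgroup.map_eq_bot_iff_of_injective _ hφ).not.mpr (hA.ne_bot k))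
      (fg_map (hA.fg k) φ) (hA.tail k).map
  choose σ hσ using himage
  have hpreimage (l : κ) : ∃ k, σ k = l ∧ Conjugate ((A k).map φ) (A l) := by
    obtain ⟨L, hLtail, hL⟩ := (hA.tail l).exists_preimage hφ (hA.ne_bot l)
    have hLne : L ≠ ⊥ := by
      rintro rfl
      exact hL.ne_bot (hA.ne_bot l) (Subgroup.map_bot φ)
    obtain ⟨k, hk⟩ := hA.cofinal hLne (fg_of_fg_map hφ (hL.fg (hA.fg l))) hLtail
    have hle : Subconjugate (A l) ((A k).map φ) := hL.symm.subconjugate.trans (hk.map φ)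
    obtain rfl := hA.antichain (hle.trans (hσ k))
    exact ⟨k, rfl, (hle.antisymm (hA.fg _) (hσ k)).symm⟩
  have hbij : Function.Bijective σ :=
    Finite.surjective_iff_bijective.mp fun l => (hpreimage l).imp fun _ h => h.1
  refine ⟨Equiv.ofBijective σ hbij, fun k => ?_⟩
  obtain ⟨l, hl, hconj⟩ := hpreimage (σ k)
  rwa [hbij.injective hl] at hconj

namespace IsLimitSystem

open Filter

variable {ι : Type*} {b : ℕ → FreeGroupBasis ι F} {r : ι → ι → Prop} {B : ι → Subgroup F}

lemma subgroupTail (hB : IsLimitSystem (hyperfilter ℕ) (iter φ) b r B) {i : ι} (hi : r i i) :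
    SubgroupTail φ (B i) :=
  subgroupTail_of_frequently <| (hB.conjugate.frequently.filter_mono Nat.hyperfilter_le_atTop).mono
    fun _ h => ⟨_, h i hi⟩

lemma exists_subconjugate {U : Ultrafilter ℕ} (hB : IsLimitSystem U (iter φ) b r B)
    {K : Subgroup F} (hne : K ≠ ⊥) (hfg : K.FG) (hK : SubgroupTail φ K) :
    ∃ i, r i i ∧ Subconjugate K (B i) := by
  obtain ⟨n, hcarries, hconj⟩ := ((hB.carries hne hfg).and hB.conjugate).exists
  obtain ⟨L, hL⟩ := hK n
  obtain ⟨i, hi, hLi⟩ := hcarries L hL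
  exact ⟨i, hi, hL.symm.subconjugate.trans ((hLi.map _).trans (hconj i hi).subconjugate)⟩

lemma exists_isTailCore [Finite ι] (hB : IsLimitSystem (hyperfilter ℕ) (iter φ) b r B)
    (hφ : Function.Injective φ) : ∃ Q : Finset ι, IsTailCore φ fun q : Q => B q := by
  classical
  have := Fintype.ofFinite ι
  obtain ⟨Q, hQr, hcof, hanti⟩ := exists_cofinal_antichain (Finset.univ.filter fun i => r i i)
    (r := fun i j => Subconjugate (B i) (B j)) (fun _ => .refl _) fun _ _ _ => .trans
  have hr (q : Q) : r q q := (Finset.mem_filter.mp (hQr q.2)).2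
  refine ⟨Q, fun q => hB.fg q, fun q => hB.ne_bot (iter_injective hφ) (hr q),
    fun q => hB.subgroupTail (hr q),
    fun h => Subtype.ext (hanti _ (Subtype.mem _) _ (Subtype.mem _) h), fun hne hfg hK => ?_⟩
  obtain ⟨i, hi, hKi⟩ := hB.exists_subconjugate hne hfg hK
  obtain ⟨q, hq, hiq⟩ := hcof i (Finset.mem_filter.mpr ⟨Finset.mem_univ i, hi⟩)
  exact ⟨⟨q, hq⟩, hKi.trans hiq⟩

theorem exists_conjugate_block [IsFreeGroup F] [Group.FG F] [Finite κ] {A : κ → Subgroup F}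
    (hB : IsLimitSystem (hyperfilter ℕ) (iter φ) b r B) (hA : IsTailCore φ A)
    (hφ : Function.Injective φ) :
    ∃ n, ∀ k, ∃ i, r i i ∧ Conjugate (block (b n) r i) (A k) := by
  obtain ⟨σ, hσ⟩ := hA.exists_perm hφ
  obtain ⟨n, hcarries, hconj⟩ := ((eventually_all.mpr fun k =>
    hB.carries (hA.ne_bot k) (hA.fg k)).and hB.conjugate).exists
  refine ⟨n, fun k => ?_⟩
  have himage := conjugate_map_iter hσ n k
  obtain ⟨i, hi, hki⟩ := hcarries _ _ himage
  obtain ⟨l, hl⟩ := hA.cofinal (hB.ne_bot (iter_injective hφ) hi) (hB.fg i) (hB.subgroupTail hi)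
  have hblock := (hconj i hi).subconjugate.trans hl
  obtain rfl := hA.antichain (himage.symm.subconjugate.trans ((hki.map _).trans hblock))
  exact ⟨i, hi, (Conjugate.of_map_subconjugate (iter_injective hφ n) (himage.fg (hA.fg _)) hki
    (hblock.trans himage.symm.subconjugate)).symm⟩

end IsLimitSystem

lemma isFixed_singleton_bot (φ : F →* F) : IsFixed φ {⊥} := by
  refine ⟨1, fun A => ?_⟩
  rw [Equiv.Perm.one_apply, Finset.mem_singleton.mp A.2, Subgroup.map_bot]
  exact Conjugate.refl ⊥

lemma isFixed_image [Fintype κ] [DecidableEq (Subgroup F)] {A : κ → Subgroup F}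
    (hA : Function.Injective A) {σ : Equiv.Perm κ}
    (hσ : ∀ k, Conjugate ((A k).map φ) (A (σ k))) : IsFixed φ (Finset.univ.image A) := by
  let e : κ ≃ Finset.univ.image A := Equiv.ofBijective
    (fun k => ⟨A k, Finset.mem_image_of_mem A (Finset.mem_univ k)⟩)
    ⟨fun k l h => hA (congrArg Subtype.val h), by simp [Function.Surjective]⟩
  refine ⟨e.permCongr σ, fun B => ?_⟩
  obtain ⟨k, rfl⟩ := e.surjective B
  rw [Equiv.permCongr_apply, e.symm_apply_apply]
  exact hσ k

end TailCore

section FixedSystem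

variable {F ι κ : Type*} [Group F] {φ : F →* F} {𝒜 : Finset (Subgroup F)}

/-- `𝒜` carries every finitely generated subgroup with an infinite tail. -/
def CarriesTails (φ : F →* F) (𝒜 : Finset (Subgroup F)) : Prop :=
  ∀ K : Subgroup F, K.FG → SubgroupTail φ K → ∃ A ∈ 𝒜, Subconjugate K A

lemma CarriesTails.carriesClass (h𝒜 : CarriesTails φ 𝒜) {g : F} (hg : HasInfiniteTail φ g) :
    CarriesClass 𝒜 g := by
  obtain ⟨A, hA, x, hx⟩ := h𝒜 _ ⟨{g}, by simp [Subgroup.zpowers_eq_closure]⟩ hg.subgroupTail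
  exact ⟨A, hA, x, hx (Subgroup.mem_zpowers g)⟩

lemma CarriesTails.carries (h𝒜 : CarriesTails φ 𝒜) {ℬ : Finset (Subgroup F)} (hℬ : IsFG ℬ)
    (hfix : IsFixed φ ℬ) : Carries 𝒜 ℬ :=
  fun K hK => h𝒜 K (hℬ K hK) (hfix.subgroupTail hK)

variable [IsFreeGroup F] [Group.FG F]

lemma IsTailCore.exists_fixed_freeFactorSystem [Finite κ] {A : κ → Subgroup F}
    (hA : IsTailCore φ A) (hφ : Function.Injective φ) (b : FreeGroupBasis ι F) {r : ι → ι → Prop}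
    (hsymm : ∀ i j, r i j → r j i) (htrans : ∀ i j k, r i j → r j k → r i k)
    (hblock : ∀ k, ∃ i, r i i ∧ Conjugate (block b r i) (A k)) :
    ∃ 𝒜, IsFreeFactorSystem 𝒜 ∧ IsFixed φ 𝒜 ∧ CarriesTails φ 𝒜 := by
  classical
  have := Fintype.ofFinite κ
  rcases isEmpty_or_nonempty κ with _ | _
  · refine ⟨{⊥}, .inl rfl, isFixed_singleton_bot φ, fun K hK htail => ?_⟩
    obtain rfl : K = ⊥ := by
      by_contra hne
      exact (hA.cofinal hne hK htail).elim fun k _ => isEmptyElim k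
    exact ⟨⊥, Finset.mem_singleton_self ⊥, .refl ⊥⟩
  choose i hi hconj using hblock
  obtain ⟨σ, hσ⟩ := hA.exists_perm hφ
  have hinj : Function.Injective fun k => block b r (i k) := fun k l h => by
    have hkl : Conjugate (block b r (i k)) (A l) := (congrArg (Conjugate · (A l)) h).mpr (hconj l)
    exact hA.antichain ((hconj k).symm.trans hkl).subconjugate
  refine ⟨_, isFreeFactorSystem_image_block b hsymm htrans hi,
    isFixed_image hinj fun k => ((hconj k).map φ).trans ((hσ k).trans (hconj (σ k)).symm),
    fun K hK htail => ?_⟩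
  obtain ⟨k, hk⟩ : ∃ k, Subconjugate K (A k) := by
    by_cases hne : K = ⊥
    · exact ⟨Classical.arbitrary κ, .of_le (hne ▸ bot_le)⟩
    · exact hA.cofinal hne hK htail
  exact ⟨_, Finset.mem_image_of_mem _ (Finset.mem_univ k),
    hk.trans (hconj k).symm.subconjugate⟩

theorem exists_fixed_freeFactorSystem (hφ : Function.Injective φ) :
    ∃ 𝒜, IsFreeFactorSystem 𝒜 ∧ IsFixed φ 𝒜 ∧ CarriesTails φ 𝒜 := by
  let δ := IsFreeGroup.basis F
  have : Finite (IsFreeGroup.Generators F) := finite_of_basis_of_fg δ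
  choose b R hb using fun n => exists_isAdapted δ δ (iter_injective hφ n)
  obtain ⟨r, B, hB⟩ := exists_isLimitSystem δ (Filter.hyperfilter ℕ) hb
  obtain ⟨Q, hQ⟩ := hB.exists_isTailCore hφ
  obtain ⟨n, hn⟩ := hB.exists_conjugate_block hQ hφ
  exact hQ.exists_fixed_freeFactorSystem hφ (b n) hB.symm hB.trans hn

end FixedSystem

end SubgroupSystem

theorem mainTheorem5_general {F : Type*} [Group F] [IsFreeGroup F] [Group.FG F] (φ : F →* F)
    (hφ : Function.Injective φ) :
    ∃ 𝒜 : Finset (Subgroup F),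
      SubgroupSystem.IsMaximalFixedFreeFactorSystem φ 𝒜 ∧
      (∀ ℬ : Finset (Subgroup F), SubgroupSystem.IsMaximalFixedFreeFactorSystem φ ℬ →
        SubgroupSystem.Equivalent ℬ 𝒜) ∧
      SubgroupSystem.CarriesTails φ 𝒜 := by
  obtain ⟨𝒜, hfree, hfix, htails⟩ := SubgroupSystem.exists_fixed_freeFactorSystem hφ
  refine ⟨𝒜, ⟨hfree, hfix, fun ℬ hℬ hℬfix _ => htails.carries hℬ.isFG hℬfix⟩,
    fun ℬ ⟨hℬ, hℬfix, hmax⟩ => ?_, htails⟩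
  have hcarries := htails.carries hℬ.isFG hℬfix
  exact ⟨hmax 𝒜 hfree hfix hcarries, hcarries⟩

theorem mainTheorem5 {F : Type*} [Group F] [IsFreeGroup F] [Group.FG F] (hF : 2 ≤ Group.rank F)
    (φ : F →* F) (hφ : Function.Injective φ) :
    ∃ 𝒜 : Finset (Subgroup F),
      SubgroupSystem.IsMaximalFixedFreeFactorSystem φ 𝒜 ∧
      (∀ ℬ : Finset (Subgroup F), SubgroupSystem.IsMaximalFixedFreeFactorSystem φ ℬ →
        SubgroupSystem.Equivalent ℬ 𝒜) ∧
      (∀ g : F, SubgroupSystem.HasInfiniteTail φ g → SubgroupSystem.CarriesClass 𝒜 g) ∧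
      (∀ ℬ : Finset (Subgroup F), SubgroupSystem.IsSystem ℬ → SubgroupSystem.IsFG ℬ →
        SubgroupSystem.IsFixed φ ℬ → SubgroupSystem.Carries 𝒜 ℬ) := by
  obtain ⟨𝒜, hmax, hunique, htails⟩ := mainTheorem5_general φ hφ
  exact ⟨𝒜, hmax, hunique, fun _ => htails.carriesClass, fun _ _ => htails.carries⟩
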